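/- Let $\mu$ be Lebesgue measure on $[0,1]$ and let $r>0$. A \emph{graphon} is a measurable function $W:[0,1]^2\to[0,1]$ with $W(x,y)=W(y,x)$ for all $x,y$; a \emph{signal} is a measurable function $f:[0,1]\to\mathbb{R}$ with $|f(x)|\le r$ for all $x$. Let $\mathcal{WL}_r$ be the set of pairs $(W,f)$ of a graphon and a signal (\emph{graphon-signals}). For integrable $W:[0,1]^2\to\mathbb{R}$ and $f:[0,1]\to\mathbb{R}$ put $$\|W\|_\square=\sup_{U,S}\Big|\int_{U\times S}W(x,y)\,dx\,dy\Big|,\qquad \|f\|_\square=\sup_{S}\Big|\int_S f\,d\mu\Big|,\qquad \|(W,f)\|_\square=\|W\|_\square+\|f\|_\square,$$ where $U,S$ range over the measurable subsets of $[0,1]$. Let $S'_{[0,1]}$ be the set of bijections $\phi:A\to B$ between measurable co-null subsets $A,B$ of $[0,1]$ that are measurable with measurable inverse and satisfy $\mu(\phi(S))=\mu(S)$ for all measurable $S\subseteq A$. For such $\phi$ put $W^\phi(x,y)=W(\phi(x),\phi(y))$ and $f^\phi(x)=f(\phi(x))$ where these are defined, and $0$ elsewhere. The \emph{cut distance} on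 $\mathcal{WL}_r$ is $$\delta_\square\big((W,f),(V,g)\big)=\inf_{\phi\in S'_{[0,1]}}\big\|(W-V^\phi,\;f-g^\phi)\big\|_\square .$$ It is a pseudometric. Let $\widetilde{\mathcal{WL}_r}$ be the quotient of $\mathcal{WL}_r$ by the relation $\delta_\square=0$, with the metric induced by $\delta_\square$. Then the metric space $(\widetilde{\mathcal{WL}_r},\delta_\square)$ is compact. Moreover, for every $c>1$ there is $\epsilon_0>0$ (depending only on $r$ and $c$) such that for every $0<\epsilon<\epsilon_0$ the space $\widetilde{\mathcal{WL}_r}$ can be covered by $$\kappa(\epsilon)=2^{k^2},\qquad k=\big\lceil 2^{\frac{9c}{4\epsilon^2}}\big\rceil,$$ open balls of radius $\epsilon$. -/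

import Mathlib

open MeasureTheory Set
open scoped unitInterval

noncomputable section

namespace GraphonSignalSpace

/-- A graphon: a symmetric measurable function `[0,1]² → [0,1]`. -/
structure Graphon where
  toFun : I × I → ℝ
  measurable : Measurable toFun
  mem_Icc : ∀ p, toFun p ∈ Icc (0 : ℝ) 1
  symm : ∀ x y, toFun (x, y) = toFun (y, x)

/-- A signal bounded by `r`: a measurable function `[0,1] → ℝ` with `|f x| ≤ r` everywhere. -/
structure Signal (r : ℝ) where
  toFun : I → ℝ
  measurable : Measurable toFun
  abs_le : ∀ x, |toFun x| ≤ r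

/-- A graphon-signal: a pair of a graphon and a signal bounded by `r`. -/
structure GraphonSignal (r : ℝ) where
  graphon : Graphon
  signal : Signal r

/-- The cut norm of a kernel on `[0,1]²`. -/
def kernelCutNorm (W : I × I → ℝ) : ℝ :=
  sSup {a | ∃ U S : Set I, MeasurableSet U ∧ MeasurableSet S ∧ a = |∫ p in U ×ˢ S, W p|}

/-- The cut norm of a signal on `[0,1]`. -/
def signalCutNorm (f : I → ℝ) : ℝ :=
  sSup {a | ∃ S : Set I, MeasurableSet S ∧ a = |∫ x in S, f x|}

/-- The cut norm of a pair `(W, f)`. -/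
def cutNorm (W : I × I → ℝ) (f : I → ℝ) : ℝ :=
  kernelCutNorm W + signalCutNorm f

/-- A measurable (in both directions) measure preserving bijection between two measurable co-null
subsets `source` and `target` of `[0,1]`. The values outside `source` and `target` are irrelevant. -/
structure CoNullBijection extends PartialEquiv I I where
  measurableSet_source : MeasurableSet source
  measurableSet_target : MeasurableSet target
  source_conull : volume sourceᶜ = 0
  target_conull : volume targetᶜ = 0
  measurable_toFun : Measurable fun x : ↥source => toFun x
  measurable_invFun : Measurable fun x : ↥target => invFun x
  measure_image : ∀ S ⊆ source, MeasurableSet S → volume (toFun '' S) = volume S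

/-- `W^φ(x, y) = W(φ x, φ y)`, set to `0` where it is not defined. -/
def kernelPull (φ : CoNullBijection) (W : I × I → ℝ) : I × I → ℝ :=
  (φ.source ×ˢ φ.source).indicator fun p => W (φ.toFun p.1, φ.toFun p.2)

/-- `f^φ(x) = f(φ x)`, set to `0` where it is not defined. -/
def signalPull (φ : CoNullBijection) (f : I → ℝ) : I → ℝ :=
  φ.source.indicator fun x => f (φ.toFun x)

/-- The cut distance between two graphon-signals: the infimum over `φ` of the cut norm of
`(W, f) - (V, g)^φ`. -/
def cutDistance {r : ℝ} (a b : GraphonSignal r) : ℝ :=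
  sInf (range fun φ : CoNullBijection =>
    cutNorm (a.graphon.toFun - kernelPull φ b.graphon.toFun)
      (a.signal.toFun - signalPull φ b.signal.toFun))

/-! ### The cut distance is a pseudometric -/

namespace CoNullBijection

/-- The identity of `[0,1]`. -/
def refl : CoNullBijection where
  toPartialEquiv := PartialEquiv.refl I
  measurableSet_source := MeasurableSet.univ
  measurableSet_target := MeasurableSet.univ
  source_conull := by simp
  target_conull := by simp
  measurable_toFun := measurable_subtype_coe
  measurable_invFun := measurable_subtype_coe
  measure_image := by intro S _ _; exact congrArg volume (image_id S)

theorem measurableSet_preimage_inter (φ : CoNullBijection) {T : Set I} (hT : MeasurableSet T) :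
    MeasurableSet (φ.source ∩ φ.toFun ⁻¹' T) := by
  have h := MeasurableSet.subtype_image φ.measurableSet_source (φ.measurable_toFun hT)
  convert h using 1
  ext x; simp [and_comm]

theorem measurableSet_preimage_inv_inter (φ : CoNullBijection) {T : Set I}
    (hT : MeasurableSet T) : MeasurableSet (φ.target ∩ φ.invFun ⁻¹' T) := by
  have h := MeasurableSet.subtype_image φ.measurableSet_target (φ.measurable_invFun hT)
  convert h using 1
  ext x; simp [and_comm]

/-- The inverse bijection. -/
def symm (φ : CoNullBijection) : CoNullBijection where
  toPartialEquiv := φ.toPartialEquiv.symm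
  measurableSet_source := φ.measurableSet_target
  measurableSet_target := φ.measurableSet_source
  source_conull := φ.target_conull
  target_conull := φ.source_conull
  measurable_toFun := φ.measurable_invFun
  measurable_invFun := φ.measurable_toFun
  measure_image := by
    intro S hS hSm
    have hS' : S ⊆ φ.target := hS
    have e : φ.invFun '' S = φ.source ∩ φ.toFun ⁻¹' S :=
      φ.toPartialEquiv.symm_image_eq_source_inter_preimage hS'
    have h := φ.measure_image (φ.invFun '' S) (by rw [e]; exact inter_subset_left)
      (by rw [e]; exact φ.measurableSet_preimage_inter hSm)
    change volume (φ.invFun '' S) = volume S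
    rw [← h, image_image]
    congr 1
    ext y
    constructor
    · rintro ⟨x, hx, rfl⟩
      change φ.toPartialEquiv (φ.toPartialEquiv.symm x) ∈ S
      rwa [φ.toPartialEquiv.right_inv (hS' hx)]
    · intro hy
      exact ⟨y, hy, φ.toPartialEquiv.right_inv (hS' hy)⟩

/-- An everywhere defined extension, by the identity, of `φ`. -/
def ext (φ : CoNullBijection) : I → I :=
  open Classical in φ.source.piecewise φ.toFun id

theorem ext_of_mem (φ : CoNullBijection) {x : I} (hx : x ∈ φ.source) : φ.ext x = φ.toFun x := by
  simp [ext, hx]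

theorem measurable_ext (φ : CoNullBijection) : Measurable φ.ext := by
  classical
  refine measurable_of_restrict_of_restrict_compl φ.measurableSet_source ?_ ?_
  · convert φ.measurable_toFun using 1
    ext x; simp [ext, x.2]
  · convert (measurable_subtype_coe : Measurable ((↑) : ↥(φ.sourceᶜ) → I)) using 1
    funext x
    have : (x : I) ∉ φ.source := x.2
    simp [ext, this]

theorem ae_mem_source (φ : CoNullBijection) : ∀ᵐ x : I, x ∈ φ.source :=
  mem_ae_iff.2 φ.source_conull

theorem ae_mem_target (φ : CoNullBijection) : ∀ᵐ x : I, x ∈ φ.target :=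
  mem_ae_iff.2 φ.target_conull

theorem measurePreserving_ext (φ : CoNullBijection) : MeasurePreserving φ.ext := by
  refine ⟨φ.measurable_ext, ?_⟩
  refine Measure.ext fun T hT => ?_
  rw [Measure.map_apply φ.measurable_ext hT]
  have h1 : volume (φ.ext ⁻¹' T) = volume (φ.source ∩ φ.toFun ⁻¹' T) := by
    apply measure_congr
    filter_upwards [φ.ae_mem_source] with x hx
    apply propext
    change φ.ext x ∈ T ↔ (x ∈ φ.source ∧ φ.toFun x ∈ T)
    rw [φ.ext_of_mem hx]; tauto
  rw [h1, ← φ.measure_image _ inter_subset_left (φ.measurableSet_preimage_inter hT)]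
  have h2 : φ.toFun '' (φ.source ∩ φ.toFun ⁻¹' T) = φ.target ∩ T := by
    rw [image_inter_preimage]
    congr 1
    exact φ.toPartialEquiv.image_source_eq_target
  rw [h2]
  apply measure_congr
  filter_upwards [φ.ae_mem_target] with x hx
  apply propext
  change (x ∈ φ.target ∧ x ∈ T) ↔ x ∈ T
  tauto

/-- The composition "first `φ`, then `ψ`", on the points where it makes sense. -/
def trans (φ ψ : CoNullBijection) : CoNullBijection where
  toPartialEquiv := φ.toPartialEquiv.trans ψ.toPartialEquiv
  measurableSet_source := φ.measurableSet_preimage_inter ψ.measurableSet_source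
  measurableSet_target := ψ.measurableSet_preimage_inv_inter φ.measurableSet_target
  source_conull := by
    rw [← mem_ae_iff]
    filter_upwards [φ.ae_mem_source, φ.measurePreserving_ext.quasiMeasurePreserving.ae
      ψ.ae_mem_source] with x hx hx'
    rw [φ.ext_of_mem hx] at hx'
    exact ⟨hx, hx'⟩
  target_conull := by
    rw [← mem_ae_iff]
    filter_upwards [ψ.symm.ae_mem_source, ψ.symm.measurePreserving_ext.quasiMeasurePreserving.ae
      φ.symm.ae_mem_source] with x hx hx'
    rw [ψ.symm.ext_of_mem hx] at hx'
    exact ⟨hx, hx'⟩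
  measurable_toFun := by
    have h : Measurable fun x : ↥(φ.toPartialEquiv.trans ψ.toPartialEquiv).source =>
        ψ.ext (φ.ext x) := ψ.measurable_ext.comp (φ.measurable_ext.comp measurable_subtype_coe)
    convert h using 1
    funext x
    have hx : (x : I) ∈ φ.source := x.2.1
    have hx' : φ.toFun x ∈ ψ.source := x.2.2
    rw [φ.ext_of_mem hx, ψ.ext_of_mem hx']
    rfl
  measurable_invFun := by
    have h : Measurable fun x : ↥(φ.toPartialEquiv.trans ψ.toPartialEquiv).target =>
        φ.symm.ext (ψ.symm.ext x) :=
      φ.symm.measurable_ext.comp (ψ.symm.measurable_ext.comp measurable_subtype_coe)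
    convert h using 1
    funext x
    have hx : (x : I) ∈ ψ.symm.source := x.2.1
    have hx' : ψ.symm.toFun x ∈ φ.symm.source := x.2.2
    rw [ψ.symm.ext_of_mem hx, φ.symm.ext_of_mem hx']
    rfl
  measure_image := by
    intro S hS hSm
    have hS1 : S ⊆ φ.source := fun x hx => (hS hx).1
    have hS2 : φ.toFun '' S ⊆ ψ.source := by
      rintro _ ⟨x, hx, rfl⟩
      exact (hS hx).2
    have e : φ.toFun '' S = φ.target ∩ φ.invFun ⁻¹' S :=
      φ.toPartialEquiv.image_eq_target_inter_inv_preimage hS1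
    have e' : (φ.toPartialEquiv.trans ψ.toPartialEquiv).toFun '' S = ψ.toFun '' (φ.toFun '' S) := by
      rw [image_image]; rfl
    rw [e', ψ.measure_image _ hS2 (by rw [e]; exact φ.measurableSet_preimage_inv_inter hSm),
      φ.measure_image S hS1 hSm]

end CoNullBijection

theorem signalPull_ae (φ : CoNullBijection) (f : I → ℝ) :
    signalPull φ f =ᵐ[volume] f ∘ φ.ext := by
  filter_upwards [φ.ae_mem_source] with x hx
  simp [signalPull, hx, φ.ext_of_mem hx]

theorem ae_prod_of_ae {P : I → Prop} (h : ∀ᵐ x : I, P x) :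
    ∀ᵐ p : I × I, P p.1 ∧ P p.2 := by
  have h1 : ∀ᵐ p : I × I, P p.1 := Measure.quasiMeasurePreserving_fst.ae h
  have h2 : ∀ᵐ p : I × I, P p.2 := Measure.quasiMeasurePreserving_snd.ae h
  exact h1.and h2

theorem kernelPull_ae (φ : CoNullBijection) (W : I × I → ℝ) :
    kernelPull φ W =ᵐ[volume] W ∘ Prod.map φ.ext φ.ext := by
  filter_upwards [ae_prod_of_ae φ.ae_mem_source] with p hp
  simp [kernelPull, Prod.map, hp.1, hp.2, φ.ext_of_mem hp.1, φ.ext_of_mem hp.2]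

theorem measurePreserving_prod (φ : CoNullBijection) :
    MeasurePreserving (Prod.map φ.ext φ.ext) (volume : Measure (I × I)) volume :=
  φ.measurePreserving_ext.prod φ.measurePreserving_ext

theorem kernelCutNorm_congr {W V : I × I → ℝ} (h : W =ᵐ[volume] V) :
    kernelCutNorm W = kernelCutNorm V := by
  unfold kernelCutNorm
  congr 1
  ext a
  have (U S : Set I) : ∫ p in U ×ˢ S, W p = ∫ p in U ×ˢ S, V p :=
    integral_congr_ae (ae_restrict_of_ae h)
  simp only [this]

theorem signalCutNorm_congr {f g : I → ℝ} (h : f =ᵐ[volume] g) :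
    signalCutNorm f = signalCutNorm g := by
  unfold signalCutNorm
  congr 1
  ext a
  have (S : Set I) : ∫ p in S, f p = ∫ p in S, g p :=
    integral_congr_ae (ae_restrict_of_ae h)
  simp only [this]

theorem abs_setIntegral_le {α : Type*} [MeasurableSpace α] {μ : Measure α} {f : α → ℝ}
    (hf : Integrable f μ) (s : Set α) : |∫ x in s, f x ∂μ| ≤ ∫ x, |f x| ∂μ :=
  (abs_integral_le_integral_abs).trans
    (setIntegral_le_integral hf.abs (Filter.Eventually.of_forall fun _ => abs_nonneg _))

theorem kernelCutNorm_bdd {W : I × I → ℝ} (hW : Integrable W) :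
    BddAbove {a | ∃ U S : Set I, MeasurableSet U ∧ MeasurableSet S ∧
      a = |∫ p in U ×ˢ S, W p|} := by
  refine ⟨∫ p, |W p|, ?_⟩
  rintro _ ⟨U, S, -, -, rfl⟩
  exact abs_setIntegral_le hW _

theorem signalCutNorm_bdd {f : I → ℝ} (hf : Integrable f) :
    BddAbove {a | ∃ S : Set I, MeasurableSet S ∧ a = |∫ x in S, f x|} := by
  refine ⟨∫ p, |f p|, ?_⟩
  rintro _ ⟨S, -, rfl⟩
  exact abs_setIntegral_le hf _

theorem le_kernelCutNorm {W : I × I → ℝ} (hW : Integrable W) {U S : Set I}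
    (hU : MeasurableSet U) (hS : MeasurableSet S) :
    |∫ p in U ×ˢ S, W p| ≤ kernelCutNorm W :=
  le_csSup (kernelCutNorm_bdd hW) ⟨U, S, hU, hS, rfl⟩

theorem le_signalCutNorm {f : I → ℝ} (hf : Integrable f) {S : Set I} (hS : MeasurableSet S) :
    |∫ x in S, f x| ≤ signalCutNorm f :=
  le_csSup (signalCutNorm_bdd hf) ⟨S, hS, rfl⟩

theorem kernelCutNorm_le {W : I × I → ℝ} {a : ℝ}
    (h : ∀ U S : Set I, MeasurableSet U → MeasurableSet S → |∫ p in U ×ˢ S, W p| ≤ a) :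
    kernelCutNorm W ≤ a := by
  refine csSup_le ⟨_, ∅, ∅, MeasurableSet.empty, MeasurableSet.empty, rfl⟩ ?_
  rintro _ ⟨U, S, hU, hS, rfl⟩
  exact h U S hU hS

theorem signalCutNorm_le {f : I → ℝ} {a : ℝ}
    (h : ∀ S : Set I, MeasurableSet S → |∫ x in S, f x| ≤ a) : signalCutNorm f ≤ a := by
  refine csSup_le ⟨_, ∅, MeasurableSet.empty, rfl⟩ ?_
  rintro _ ⟨S, hS, rfl⟩
  exact h S hS

theorem cutNorm_nonneg (W : I × I → ℝ) (f : I → ℝ) : 0 ≤ cutNorm W f := by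
  refine add_nonneg (Real.sSup_nonneg ?_) (Real.sSup_nonneg ?_)
  · rintro _ ⟨U, S, -, -, rfl⟩; exact abs_nonneg _
  · rintro _ ⟨S, -, rfl⟩; exact abs_nonneg _

theorem cutNorm_zero : cutNorm 0 0 = 0 := by
  refine le_antisymm ?_ (cutNorm_nonneg _ _)
  have h1 : kernelCutNorm 0 ≤ 0 := kernelCutNorm_le fun U S _ _ => by simp
  have h2 : signalCutNorm 0 ≤ 0 := signalCutNorm_le fun S _ => by simp
  unfold cutNorm; linarith

theorem cutNorm_congr {W V : I × I → ℝ} {f g : I → ℝ} (h : W =ᵐ[volume] V)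
    (h' : f =ᵐ[volume] g) : cutNorm W f = cutNorm V g := by
  rw [cutNorm, cutNorm, kernelCutNorm_congr h, signalCutNorm_congr h']

theorem cutNorm_sub_comm (W V : I × I → ℝ) (f g : I → ℝ) :
    cutNorm (W - V) (f - g) = cutNorm (V - W) (g - f) := by
  have h1 (U S : Set I) : |∫ p in U ×ˢ S, (W - V) p| = |∫ p in U ×ˢ S, (V - W) p| := by
    rw [← abs_neg, ← integral_neg]; simp
  have h2 (S : Set I) : |∫ p in S, (f - g) p| = |∫ p in S, (g - f) p| := by
    rw [← abs_neg, ← integral_neg]; simp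
  simp only [cutNorm, kernelCutNorm, signalCutNorm, h1, h2]

theorem cutNorm_add_le {W V : I × I → ℝ} {f g : I → ℝ} (hW : Integrable W) (hV : Integrable V)
    (hf : Integrable f) (hg : Integrable g) :
    cutNorm (W + V) (f + g) ≤ cutNorm W f + cutNorm V g := by
  have h1 : kernelCutNorm (W + V) ≤ kernelCutNorm W + kernelCutNorm V :=
    kernelCutNorm_le fun U S hU hS => by
      have : ∫ p in U ×ˢ S, (W + V) p = (∫ p in U ×ˢ S, W p) + ∫ p in U ×ˢ S, V p :=
        integral_add hW.integrableOn hV.integrableOn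
      rw [this]
      exact (abs_add_le _ _).trans
        (add_le_add (le_kernelCutNorm hW hU hS) (le_kernelCutNorm hV hU hS))
  have h2 : signalCutNorm (f + g) ≤ signalCutNorm f + signalCutNorm g :=
    signalCutNorm_le fun S hS => by
      have : ∫ p in S, (f + g) p = (∫ p in S, f p) + ∫ p in S, g p :=
        integral_add hf.integrableOn hg.integrableOn
      rw [this]
      exact (abs_add_le _ _).trans
        (add_le_add (le_signalCutNorm hf hS) (le_signalCutNorm hg hS))
  unfold cutNorm; linarith

theorem integrable_kernelPull (φ : CoNullBijection) {W : I × I → ℝ} (hW : Integrable W) :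
    Integrable (kernelPull φ W) :=
  ((measurePreserving_prod φ).integrable_comp_of_integrable hW).congr (kernelPull_ae φ W).symm

theorem integrable_signalPull (φ : CoNullBijection) {f : I → ℝ} (hf : Integrable f) :
    Integrable (signalPull φ f) :=
  (φ.measurePreserving_ext.integrable_comp_of_integrable hf).congr (signalPull_ae φ f).symm

theorem setIntegral_comp {α : Type*} [MeasurableSpace α] {μ : Measure α} {T : α → α}
    (hT : MeasurePreserving T μ μ) {f : α → ℝ} (hf : Integrable f μ) {s : Set α}
    (hs : MeasurableSet s) : ∫ x in T ⁻¹' s, f (T x) ∂μ = ∫ x in s, f x ∂μ := by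
  have h := hT.restrict_preimage hs
  rw [← integral_map (μ := μ.restrict (T ⁻¹' s)) (f := f) hT.measurable.aemeasurable
    (by rw [h.map_eq]; exact hf.aestronglyMeasurable.restrict), h.map_eq]

theorem cutNorm_le_pull (φ : CoNullBijection) {W : I × I → ℝ} {f : I → ℝ} (hW : Integrable W)
    (hf : Integrable f) : cutNorm W f ≤ cutNorm (kernelPull φ W) (signalPull φ f) := by
  rw [cutNorm_congr (kernelPull_ae φ W) (signalPull_ae φ f)]
  refine add_le_add ?_ ?_
  · refine kernelCutNorm_le fun U S hU hS => ?_
    rw [← setIntegral_comp (measurePreserving_prod φ) hW (hU.prod hS)]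
    exact le_kernelCutNorm (U := φ.ext ⁻¹' U) (S := φ.ext ⁻¹' S)
      ((measurePreserving_prod φ).integrable_comp_of_integrable hW)
      (φ.measurable_ext hU) (φ.measurable_ext hS)
  · refine signalCutNorm_le fun S hS => ?_
    rw [← setIntegral_comp φ.measurePreserving_ext hf hS]
    exact le_signalCutNorm (φ.measurePreserving_ext.integrable_comp_of_integrable hf)
      (φ.measurable_ext hS)

theorem kernelPull_sub (φ : CoNullBijection) (W V : I × I → ℝ) :
    kernelPull φ (W - V) = kernelPull φ W - kernelPull φ V :=
  indicator_sub _ (fun p : I × I => W (φ.toFun p.1, φ.toFun p.2))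
    fun p : I × I => V (φ.toFun p.1, φ.toFun p.2)

theorem signalPull_sub (φ : CoNullBijection) (f g : I → ℝ) :
    signalPull φ (f - g) = signalPull φ f - signalPull φ g :=
  indicator_sub _ (fun p => f (φ.toFun p)) fun p => g (φ.toFun p)

theorem kernelPull_trans (φ ψ : CoNullBijection) (W : I × I → ℝ) :
    kernelPull (φ.trans ψ) W = kernelPull φ (kernelPull ψ W) := by
  classical
  funext p
  have h (x : I) : x ∈ (φ.trans ψ).source ↔ x ∈ φ.source ∧ φ.toFun x ∈ ψ.source := Iff.rfl
  have h' (x : I) : (φ.trans ψ).toFun x = ψ.toFun (φ.toFun x) := rfl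
  simp only [kernelPull, indicator_apply, mem_prod, h, h']
  split_ifs <;> first | rfl | tauto

theorem signalPull_trans (φ ψ : CoNullBijection) (f : I → ℝ) :
    signalPull (φ.trans ψ) f = signalPull φ (signalPull ψ f) := by
  classical
  funext p
  have h (x : I) : x ∈ (φ.trans ψ).source ↔ x ∈ φ.source ∧ φ.toFun x ∈ ψ.source := Iff.rfl
  have h' (x : I) : (φ.trans ψ).toFun x = ψ.toFun (φ.toFun x) := rfl
  simp only [signalPull, indicator_apply, h, h']
  split_ifs <;> first | rfl | tauto

theorem CoNullBijection.symm_apply (φ : CoNullBijection) {x : I} (hx : x ∈ φ.source) :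
    φ.toFun x ∈ φ.symm.source ∧ φ.symm.toFun (φ.toFun x) = x :=
  ⟨φ.toPartialEquiv.map_source hx, φ.toPartialEquiv.left_inv hx⟩

theorem kernelPull_symm (φ : CoNullBijection) (W : I × I → ℝ) :
    kernelPull φ (kernelPull φ.symm W) =ᵐ[volume] W := by
  filter_upwards [ae_prod_of_ae φ.ae_mem_source] with p hp
  simp [kernelPull, hp.1, hp.2, (φ.symm_apply hp.1).1, (φ.symm_apply hp.2).1,
    (φ.symm_apply hp.1).2, (φ.symm_apply hp.2).2]

theorem signalPull_symm (φ : CoNullBijection) (f : I → ℝ) :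
    signalPull φ (signalPull φ.symm f) =ᵐ[volume] f := by
  filter_upwards [φ.ae_mem_source] with p hp
  simp [signalPull, hp, (φ.symm_apply hp).1, (φ.symm_apply hp).2]

theorem cutNorm_pull (φ : CoNullBijection) {W : I × I → ℝ} {f : I → ℝ} (hW : Integrable W)
    (hf : Integrable f) : cutNorm (kernelPull φ W) (signalPull φ f) = cutNorm W f := by
  refine le_antisymm ?_ (cutNorm_le_pull φ hW hf)
  refine (cutNorm_le_pull φ.symm (integrable_kernelPull φ hW)
    (integrable_signalPull φ hf)).trans_eq ?_
  exact cutNorm_congr (kernelPull_symm φ.symm W) (signalPull_symm φ.symm f)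

theorem Graphon.integrable (W : Graphon) : Integrable W.toFun := by
  refine Integrable.of_bound W.measurable.aestronglyMeasurable 1
    (Filter.Eventually.of_forall fun p => ?_)
  rw [Real.norm_eq_abs, abs_of_nonneg (W.mem_Icc p).1]
  exact (W.mem_Icc p).2

theorem Signal.integrable {r : ℝ} (f : Signal r) : Integrable f.toFun :=
  Integrable.of_bound f.measurable.aestronglyMeasurable r (Filter.Eventually.of_forall f.abs_le)

section Distance

variable {r : ℝ}

theorem cutDistance_le (a b : GraphonSignal r) (φ : CoNullBijection) :
    cutDistance a b ≤ cutNorm (a.graphon.toFun - kernelPull φ b.graphon.toFun)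
      (a.signal.toFun - signalPull φ b.signal.toFun) := by
  refine csInf_le ⟨0, ?_⟩ ⟨φ, rfl⟩
  rintro _ ⟨ψ, rfl⟩
  exact cutNorm_nonneg _ _

theorem le_cutDistance {a b : GraphonSignal r} {t : ℝ}
    (h : ∀ φ : CoNullBijection, t ≤ cutNorm (a.graphon.toFun - kernelPull φ b.graphon.toFun)
      (a.signal.toFun - signalPull φ b.signal.toFun)) : t ≤ cutDistance a b := by
  refine le_csInf ⟨_, CoNullBijection.refl, rfl⟩ ?_
  rintro _ ⟨φ, rfl⟩
  exact h φ

theorem cutDistance_self (a : GraphonSignal r) : cutDistance a a = 0 := by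
  refine le_antisymm ((cutDistance_le a a CoNullBijection.refl).trans_eq ?_)
    (le_cutDistance fun _ => cutNorm_nonneg _ _)
  have h1 : kernelPull CoNullBijection.refl a.graphon.toFun = a.graphon.toFun := by
    funext p; exact indicator_of_mem (show p ∈ univ ×ˢ univ by simp) _
  have h2 : signalPull CoNullBijection.refl a.signal.toFun = a.signal.toFun := by
    funext p; exact indicator_of_mem (mem_univ p) _
  rw [h1, h2, sub_self, sub_self, cutNorm_zero]

theorem cutDistance_comm_le (a b : GraphonSignal r) : cutDistance a b ≤ cutDistance b a := by
  refine le_cutDistance fun φ => ?_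
  refine (cutDistance_le a b φ.symm).trans ?_
  have hW := a.graphon.integrable.sub (integrable_kernelPull φ.symm b.graphon.integrable)
  have hf := a.signal.integrable.sub (integrable_signalPull φ.symm b.signal.integrable)
  rw [← cutNorm_pull φ hW hf, kernelPull_sub, signalPull_sub, cutNorm_sub_comm]
  exact (cutNorm_congr ((kernelPull_symm φ _).sub (Filter.EventuallyEq.refl _ _))
    ((signalPull_symm φ _).sub (Filter.EventuallyEq.refl _ _))).le

theorem cutDistance_triangle (a b c : GraphonSignal r) :
    cutDistance a c ≤ cutDistance a b + cutDistance b c := by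
  rw [← sub_le_iff_le_add]
  refine le_cutDistance fun φ => ?_
  rw [sub_le_iff_le_add, ← sub_le_iff_le_add']
  refine le_cutDistance fun ψ => ?_
  rw [sub_le_iff_le_add']
  refine (cutDistance_le a c (φ.trans ψ)).trans ?_
  have hW := b.graphon.integrable.sub (integrable_kernelPull ψ c.graphon.integrable)
  have hf := b.signal.integrable.sub (integrable_signalPull ψ c.signal.integrable)
  rw [← cutNorm_pull φ hW hf]
  refine le_trans (le_of_eq ?_) (cutNorm_add_le
    (a.graphon.integrable.sub (integrable_kernelPull φ b.graphon.integrable))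
    (integrable_kernelPull φ hW)
    (a.signal.integrable.sub (integrable_signalPull φ b.signal.integrable))
    (integrable_signalPull φ hf))
  rw [kernelPull_sub, signalPull_sub, kernelPull_trans, signalPull_trans, sub_add_sub_cancel,
    sub_add_sub_cancel]

end Distance

/-- The cut distance as a pseudometric on graphon-signals. -/
instance (r : ℝ) : PseudoMetricSpace (GraphonSignal r) where
  dist := cutDistance
  dist_self := cutDistance_self
  dist_comm a b := le_antisymm (cutDistance_comm_le a b) (cutDistance_comm_le b a)
  dist_triangle := cutDistance_triangle

/-- The metric space of graphon-signals modulo zero cut distance: the quotient of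
`GraphonSignal r` by the relation `dist a b = 0`, with the induced metric. -/
abbrev QuotientSpace (r : ℝ) : Type := SeparationQuotient (GraphonSignal r)

end GraphonSignalSpace

end

open MeasureTheory Set
open scoped unitInterval

noncomputable section

namespace GraphonSignalSpace

/-! ### Rearrangements of the unit interval -/

section Cdf

open ProbabilityTheory Filter Topology

variable (ν : Measure ℝ)

/-! Compactness is completeness plus total boundedness, and the latter comes from the explicit
covering bound.

Covering. This is a weak regularity argument (Frieze–Kannan). The centred kernel `W - 1/2` has
squared `L²` norm at most `1/4`. While its cut norm exceeds `e`, subtracting a rectangle of height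
`±e` lowers that energy by at least `e²`, so `n > 1/(4e²)` rectangles leave a remainder of cut norm
at most `e` (`exists_cutSum_approx`). The sides of the rectangles, together with `n + 1` levels of
the signal, cut `[0,1]` into `(n+1)4^n` parts. Up to rearrangement only the signs of the rectangles
and the measures of the parts matter: sorting `[0,1]` by parts is a measure preserving bijection, so
two partitions with close cumulative measures can be matched outside a small set
(`exists_matching`). Rounding the cumulative measures gives a finite code, and equal codes force
small distance (`exists_code`). Choosing `e` just below `ε/2` and counting codes gives the bound
(`exists_cover`).

Completeness. Along a fast Cauchy sequence, near-optimal bijections are composed so that all terms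
live on one copy of `[0,1]`. The integrals over each rectangle then converge at a rate independent
of the rectangle, so a weak `L²` limit is also a limit in cut norm (`completeSpace_graphonSignal`).
-/

theorem continuous_cdf [IsProbabilityMeasure ν] [NullSingletonClass ν] : Continuous (cdf ν) := by
  refine continuous_iff_continuousAt.2 fun a => ?_
  rw [(monotone_cdf ν).continuousAt_iff_leftLim_eq_rightLim, StieltjesFunction.rightLim_eq]
  refine le_antisymm ((monotone_cdf ν).leftLim_le le_rfl) ?_
  have h : (cdf ν).measure {a} = 0 := by rw [measure_cdf]; exact measure_singleton a
  rw [StieltjesFunction.measure_singleton, ENNReal.ofReal_eq_zero] at h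
  linarith

theorem exists_cdf_eq [IsProbabilityMeasure ν] [NullSingletonClass ν] {a : ℝ} (h0 : 0 < a)
    (h1 : a < 1) : ∃ z, cdf ν z = a :=
  mem_range_of_exists_le_of_exists_ge (continuous_cdf ν)
    (((tendsto_cdf_atBot ν).eventually_le_const h0).exists)
    (((tendsto_cdf_atTop ν).eventually_const_le h1).exists)

/-- The cumulative distribution function as a map into the unit interval. -/
def cdfUnit (z : ℝ) : I := ⟨cdf ν z, cdf_nonneg ν z, cdf_le_one ν z⟩

theorem monotone_cdfUnit : Monotone (cdfUnit ν) := fun _ _ h => monotone_cdf ν h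

/-- The probability integral transform. Without atoms the distribution function takes every value in
`(0,1)`, so its sublevel sets can be compared with half-lines of known mass. -/
theorem measurePreserving_cdfUnit [IsProbabilityMeasure ν] [NullSingletonClass ν] :
    MeasurePreserving (cdfUnit ν) ν volume := by
  have hm : Measurable (cdfUnit ν) := (monotone_cdfUnit ν).measurable
  refine ⟨hm, ?_⟩
  have : IsFiniteMeasure (ν.map (cdfUnit ν)) := Measure.isFiniteMeasure_map ν _
  refine Measure.ext_of_Iic _ _ fun a => ?_
  rw [Measure.map_apply hm measurableSet_Iic, unitInterval.volume_Iic]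
  have key : ν.real (cdfUnit ν ⁻¹' Iic a) = a := by
    refine le_antisymm ?_ ?_
    · rcases eq_or_lt_of_le a.2.2 with h | h
      · rw [h]; exact measureReal_le_one
      -- The distribution function may stay equal to `a` to the right of a point where it reaches
      -- `a`, so the sublevel set is compared with half-lines of mass `b > a` instead.
      · refine le_of_forall_gt_imp_ge_of_dense fun b hb => ?_
        rcases lt_or_ge b 1 with hb1 | hb1
        · obtain ⟨z, hz⟩ := exists_cdf_eq ν (a.2.1.trans_lt hb) hb1
          rw [← hz, cdf_eq_real]
          refine measureReal_mono fun y hy => ?_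
          by_contra hyz
          have h1 : cdf ν y ≤ a := hy
          have h2 := monotone_cdf ν (not_le.1 hyz).le
          linarith
        · exact measureReal_le_one.trans hb1
    · rcases eq_or_lt_of_le a.2.2 with h | h
      · have : cdfUnit ν ⁻¹' Iic a = univ := eq_univ_of_forall fun y => by
          change cdf ν y ≤ a
          rw [h]; exact cdf_le_one ν y
        rw [this, h]; simp
      · rcases eq_or_lt_of_le a.2.1 with h' | h'
        · rw [← h']; exact measureReal_nonneg
        · obtain ⟨z, hz⟩ := exists_cdf_eq ν h' h
          conv_lhs => rw [← hz, cdf_eq_real]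
          refine measureReal_mono fun y hy => ?_
          exact (monotone_cdf ν hy).trans_eq hz
  rw [← key, ofReal_measureReal]

end Cdf

/-- A measure preserving self-map of `[0,1]` that is injective on a co-null measurable set restricts
to a co-null bijection. -/
theorem exists_coNullBijection_of_injOn {T : I → I} (hT : MeasurePreserving T) {A : Set I}
    (hA : MeasurableSet A) (hA0 : volume Aᶜ = 0) (hinj : InjOn T A) :
    ∃ φ : CoNullBijection, φ.source = A ∧ φ.toFun = T := by
  have hpre (S : Set I) (hSA : S ⊆ A) : T ⁻¹' (T '' S) =ᵐ[volume] S := by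
    filter_upwards [mem_ae_iff.2 hA0] with x hx
    refine propext ⟨?_, fun h => mem_image_of_mem T h⟩
    rintro ⟨y, hy, hyx⟩
    rwa [← hinj (hSA hy) hx hyx]
  -- Lusin–Souslin: an injective measurable map between standard Borel spaces sends measurable sets
  -- to measurable sets.
  have himg (S : Set I) (hSA : S ⊆ A) (hS : MeasurableSet S) : MeasurableSet (T '' S) :=
    hS.image_of_measurable_injOn hT.measurable (hinj.mono hSA)
  have hvol (S : Set I) (hSA : S ⊆ A) (hS : MeasurableSet S) : volume (T '' S) = volume S := by
    rw [← hT.measure_preimage (himg S hSA hS).nullMeasurableSet, measure_congr (hpre S hSA)]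
  let e := hinj.toPartialEquiv T A
  refine ⟨{ toPartialEquiv := e
            measurableSet_source := hA
            measurableSet_target := himg A subset_rfl hA
            source_conull := hA0
            target_conull := ?_
            measurable_toFun := hT.measurable.comp measurable_subtype_coe
            measurable_invFun := ?_
            measure_image := hvol }, rfl, rfl⟩
  · change volume (T '' A)ᶜ = 0
    rw [prob_compl_eq_zero_iff (himg A subset_rfl hA), hvol A subset_rfl hA,
      ← prob_compl_eq_zero_iff hA]
    exact hA0
  · intro S hS
    have h := himg (A ∩ S) inter_subset_left (hA.inter hS)
    have : (fun x : e.target => e.invFun x) ⁻¹' S = Subtype.val ⁻¹' (T '' (A ∩ S)) := by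
      ext ⟨y, hy⟩
      constructor
      · intro hyS
        exact ⟨e.invFun y, ⟨e.map_target hy, hyS⟩, e.right_inv hy⟩
      · rintro ⟨x, ⟨hxA, hxS⟩, hxy⟩
        change e.invFun y ∈ S
        have : y = e x := hxy.symm
        rw [this]
        have h2 : e.invFun (e x) = x := e.left_inv hxA
        rwa [h2]
    rw [this]
    exact measurable_subtype_coe h

/-- Sorting the points of `[0,1]` by the values of an injective measurable function `G` is, up to
null sets, a measure preserving bijection. -/
theorem exists_sorting {G : I → ℝ} (hG : Measurable G) (hinj : Function.Injective G) :
    ∃ φ : CoNullBijection, ∀ x, (φ.toFun x : ℝ) = volume.real {y | G y ≤ G x} := by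
  let ν : Measure ℝ := volume.map G
  have : IsProbabilityMeasure ν := Measure.isProbabilityMeasure_map hG.aemeasurable
  have : NullSingletonClass ν := ⟨fun z => by
    rw [Measure.map_apply hG (measurableSet_singleton z)]
    exact Set.Subsingleton.measure_zero
      (fun x hx y hy => hinj ((hx : G x = z).trans (hy : G y = z).symm)) _⟩
  have hT : MeasurePreserving (cdfUnit ν ∘ G) :=
    (measurePreserving_cdfUnit ν).comp ⟨hG, rfl⟩
  -- If `G x < G y` have the same image, some rational `a` lies between them and shares that image.
  -- Removing the countably many fibres over images of rationals, each null, therefore restores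
  -- injectivity.
  let A : Set I := (⋃ a : ℚ, (cdfUnit ν ∘ G) ⁻¹' {cdfUnit ν a})ᶜ
  have hA : MeasurableSet A :=
    (MeasurableSet.iUnion fun a => hT.measurable (measurableSet_singleton _)).compl
  obtain ⟨φ, -, hφ⟩ := exists_coNullBijection_of_injOn hT hA
    (by
      rw [compl_compl]
      refine measure_iUnion_null fun a => ?_
      rw [hT.measure_preimage (measurableSet_singleton _).nullMeasurableSet]
      exact measure_singleton _)
    (by
      have aux (x y : I) (hx : x ∈ A) (h : (cdfUnit ν ∘ G) x = (cdfUnit ν ∘ G) y) :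
          ¬ G x < G y := by
        intro hlt
        obtain ⟨a, ha1, ha2⟩ := exists_rat_btwn hlt
        refine hx (mem_iUnion.2 ⟨a, le_antisymm (monotone_cdfUnit ν ha1.le) ?_⟩)
        rw [h]
        exact monotone_cdfUnit ν ha2.le
      intro x hx y hy h
      exact hinj (le_antisymm (not_lt.1 (aux y x hy h.symm)) (not_lt.1 (aux x y hx h))))
  refine ⟨φ, fun x => ?_⟩
  rw [hφ]
  change ProbabilityTheory.cdf ν (G x) = _
  rw [ProbabilityTheory.cdf_eq_real, map_measureReal_apply hG measurableSet_Iic]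
  rfl

/-- Sorting by part, with ties broken by position, sends part `i` into the interval between two
consecutive cumulative measures. The tie-breaker `x / 2` stays below `1`, so it never reverses the
order of parts. -/
theorem exists_sorting_of_partition {m : ℕ} {p : I → Fin m} (hp : Measurable p) :
    ∃ φ : CoNullBijection, ∀ x i,
      (p x ≤ i → (φ.toFun x : ℝ) ≤ volume.real {y | p y ≤ i}) ∧
      (i < p x → volume.real {y | p y ≤ i} ≤ (φ.toFun x : ℝ)) := by
  let G : I → ℝ := fun x => ((p x : ℕ) : ℝ) + (x : ℝ) / 2
  have hlt (x y : I) (h : p x < p y) : G x < G y := by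
    have h1 : ((p x : ℕ) : ℝ) + 1 ≤ (p y : ℕ) := by exact_mod_cast h
    have := x.2.2
    have := y.2.1
    simp only [G]; linarith
  have hG : Measurable G :=
    ((measurable_from_top (f := fun i : Fin m => ((i : ℕ) : ℝ))).comp hp).add
      (measurable_subtype_coe.div_const 2)
  have hinj : Function.Injective G := by
    intro x y h
    rcases lt_trichotomy (p x) (p y) with h' | h' | h'
    · exact absurd h (hlt x y h').ne
    · simp only [G, h'] at h
      exact Subtype.ext (by linarith)
    · exact absurd h (hlt y x h').ne'
  obtain ⟨φ, hφ⟩ := exists_sorting hG hinj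
  refine ⟨φ, fun x i => ⟨fun h => ?_, fun h => ?_⟩⟩
  · rw [hφ]
    refine measureReal_mono fun y (hy : G y ≤ G x) => ?_
    by_contra hyi
    exact absurd hy (not_le.2 (hlt x y (h.trans_lt (not_le.1 hyi))))
  · rw [hφ]
    exact measureReal_mono fun y (hy : p y ≤ i) => (hlt y x (hy.trans_lt h)).le

/-- Two finite partitions of `[0,1]` can be matched by a co-null bijection up to the sum of the
differences of their cumulative measures. -/
theorem exists_matching {m : ℕ} {p q : I → Fin m} (hp : Measurable p) (hq : Measurable q) :
    ∃ φ : CoNullBijection, volume.real {x | p x ≠ q (φ.ext x)} ≤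
      ∑ i, |volume.real {x | p x ≤ i} - volume.real {x | q x ≤ i}| := by
  obtain ⟨α, hα⟩ := exists_sorting_of_partition hp
  obtain ⟨β, hβ⟩ := exists_sorting_of_partition hq
  let c : Fin m → ℝ := fun i => volume.real {x | p x ≤ i}
  let d : Fin m → ℝ := fun i => volume.real {x | q x ≤ i}
  have hc (i) : c i ∈ I := ⟨measureReal_nonneg, measureReal_le_one⟩
  have hd (i) : d i ∈ I := ⟨measureReal_nonneg, measureReal_le_one⟩
  -- With both partitions sorted, `x` and its partner share the image `t = α x`. If their parts
  -- differ and `i` is the smaller one, then `t` lies between the two cumulative measures at `i`,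
  -- that is, in `J i`.
  let J : Fin m → Set I := fun i => uIcc ⟨c i, hc i⟩ ⟨d i, hd i⟩
  refine ⟨α.trans β.symm, ?_⟩
  have hsub : {x | p x ≠ q ((α.trans β.symm).ext x)} ≤ᵐ[volume] ⋃ i, α.ext ⁻¹' J i := by
    filter_upwards [(α.trans β.symm).ae_mem_source] with x hx hne
    change p x ≠ q ((α.trans β.symm).ext x) at hne
    have hxα : x ∈ α.source := hx.1
    have hxβ : α.toFun x ∈ β.target := hx.2
    rw [(α.trans β.symm).ext_of_mem hx] at hne
    have hval : (α.trans β.symm).toFun x = β.invFun (α.toFun x) := rfl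
    rw [hval] at hne
    have hb : β.toFun (β.invFun (α.toFun x)) = α.toFun x := β.right_inv hxβ
    change x ∈ ⋃ i, α.ext ⁻¹' J i
    refine mem_iUnion.2 ?_
    simp only [mem_preimage, α.ext_of_mem hxα]
    rcases lt_or_gt_of_ne hne with h | h
    · refine ⟨p x, mem_uIcc.2 (Or.inr ⟨?_, (hα x _).1 le_rfl⟩)⟩
      have := (hβ _ _).2 h
      rwa [hb] at this
    · refine ⟨q (β.invFun (α.toFun x)), mem_uIcc.2 (Or.inl ⟨(hα x _).2 h, ?_⟩)⟩
      have := (hβ (β.invFun (α.toFun x)) _).1 le_rfl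
      rwa [hb] at this
  calc volume.real {x | p x ≠ q ((α.trans β.symm).ext x)}
      ≤ volume.real (⋃ i, α.ext ⁻¹' J i) :=
        ENNReal.toReal_mono (measure_ne_top _ _) (measure_mono_ae hsub)
    _ ≤ ∑ i, volume.real (α.ext ⁻¹' J i) := measureReal_iUnion_fintype_le _
    _ = ∑ i, |c i - d i| := by
        refine Finset.sum_congr rfl fun i _ => ?_
        rw [α.measurePreserving_ext.measureReal_preimage measurableSet_uIcc.nullMeasurableSet,
          measureReal_def, unitInterval.volume_uIcc, abs_sub_comm]
        simp [edist_dist, Subtype.dist_eq, Real.dist_eq]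

/-! ### Cut decomposition of bounded kernels -/

/-- The value at `(x, y)` of a signed sum `∑ i, ±e * 1_{S i}(x) * 1_{T i}(y)`, where `a` and `b`
record which sets `S i` contain `x` and which sets `T i` contain `y`. -/
def cutSum (e : ℝ) {n : ℕ} (τ a b : Fin n → Bool) : ℝ :=
  ∑ i, if a i ∧ b i then (if τ i then e else -e) else 0

theorem abs_cutSum_le {e : ℝ} (he : 0 ≤ e) {n : ℕ} (τ a b : Fin n → Bool) :
    |cutSum e τ a b| ≤ n * e := by
  refine (Finset.abs_sum_le_sum_abs _ _).trans ?_
  have : ∀ i ∈ (Finset.univ : Finset (Fin n)),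
      |if a i ∧ b i then (if τ i then e else -e) else 0| ≤ e := by
    intro i _
    split_ifs <;> simp [abs_of_nonneg he, he]
  refine (Finset.sum_le_card_nsmul _ _ _ this).trans_eq ?_
  simp

theorem cutSum_false (e : ℝ) {n : ℕ} (τ b : Fin n → Bool) :
    cutSum e τ (fun _ => false) b = 0 := by
  simp [cutSum]

theorem cutSum_cons (e : ℝ) {n : ℕ} (s u v : Bool) (τ a b : Fin n → Bool) :
    cutSum e (Fin.cons s τ : Fin (n + 1) → Bool) (Fin.cons u a : Fin (n + 1) → Bool)
      (Fin.cons v b : Fin (n + 1) → Bool) =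
      (if u ∧ v then (if s then e else -e) else 0) + cutSum e τ a b := by
  simp [cutSum, Fin.sum_univ_succ]

theorem measurable_cutSum (e : ℝ) {n : ℕ} (τ : Fin n → Bool) {a b : I → Fin n → Bool}
    (ha : Measurable a) (hb : Measurable b) :
    Measurable fun p : I × I => cutSum e τ (a p.1) (b p.2) :=
  (measurable_of_finite fun q : (Fin n → Bool) × (Fin n → Bool) => cutSum e τ q.1 q.2).comp
    ((ha.comp measurable_fst).prodMk (hb.comp measurable_snd))

theorem integrable_of_abs_le {α : Type*} [MeasurableSpace α] {μ : Measure α} [IsFiniteMeasure μ]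
    {f : α → ℝ} (hf : Measurable f) {B : ℝ} (hB : ∀ x, |f x| ≤ B) : Integrable f μ :=
  Integrable.of_bound hf.aestronglyMeasurable B (Filter.Eventually.of_forall hB)

/-- The energy decrement: expanding the square, the cross term gains at least `2 * e ^ 2`, and the
indicator costs at most `e ^ 2` because `A` has measure at most one. -/
theorem integral_sub_indicator_sq_le {α : Type*} [MeasurableSpace α] {μ : Measure α}
    [IsProbabilityMeasure μ] {f : α → ℝ} (hf : Measurable f) {B : ℝ} (hB : ∀ x, |f x| ≤ B)
    {A : Set α} (hA : MeasurableSet A) {e : ℝ} (h : e ^ 2 ≤ e * ∫ x in A, f x ∂μ) :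
    ∫ x, (f x - A.indicator (fun _ => e) x) ^ 2 ∂μ ≤ ∫ x, f x ^ 2 ∂μ - e ^ 2 := by
  have h1 : ∀ x, (f x - A.indicator (fun _ => e) x) ^ 2 =
      f x ^ 2 - (2 * e * A.indicator f x - A.indicator (fun _ => e ^ 2) x) := by
    intro x
    by_cases hx : x ∈ A
    · simp only [indicator_of_mem hx]; ring
    · simp only [indicator_of_notMem hx]; ring
  have i1 : Integrable (fun x => f x ^ 2) μ :=
    integrable_of_abs_le (hf.pow_const 2) (B := B ^ 2) fun x => by
      rw [abs_pow]; exact pow_le_pow_left₀ (abs_nonneg _) (hB x) 2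
  have i2 : Integrable (fun x => 2 * e * A.indicator f x) μ :=
    ((integrable_of_abs_le hf hB).indicator hA).const_mul _
  have i3 : Integrable (A.indicator fun _ => e ^ 2) μ := (integrable_const _).indicator hA
  have i4 : Integrable (fun x => 2 * e * A.indicator f x - A.indicator (fun _ => e ^ 2) x) μ :=
    i2.sub i3
  simp_rw [h1]
  rw [integral_sub i1 i4, integral_sub i2 i3, integral_const_mul, integral_indicator hA,
    integral_indicator hA, setIntegral_const, smul_eq_mul]
  have : μ.real A * e ^ 2 ≤ 1 * e ^ 2 :=
    mul_le_mul_of_nonneg_right measureReal_le_one (sq_nonneg e)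
  linarith

/-- A bounded kernel of small `L²` norm is within `e` in cut norm of a sum of `n` signed
rectangles of height `e`. -/
theorem exists_cutSum_approx {e : ℝ} (he : 0 < e) (n : ℕ) :
    ∀ {W : I × I → ℝ}, Measurable W → ∀ {B : ℝ}, (∀ p, |W p| ≤ B) →
      ∫ p, W p ^ 2 < n * e ^ 2 →
      ∃ (τ : Fin n → Bool) (a b : I → Fin n → Bool), Measurable a ∧ Measurable b ∧
        kernelCutNorm (fun p => W p - cutSum e τ (a p.1) (b p.2)) ≤ e := by
  classical
  induction n with
  | zero =>
    intro W _ B _ h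
    have : 0 ≤ ∫ p, W p ^ 2 := integral_nonneg fun p => sq_nonneg _
    simp at h; linarith
  | succ n ih =>
    intro W hW B hB h
    by_cases hcut : kernelCutNorm W ≤ e
    -- When the cut norm is already small, the sum is padded with empty rectangles, so that it
    -- always has exactly `n` terms.
    · refine ⟨fun _ => true, fun _ _ => false, fun _ _ => false, measurable_const,
        measurable_const, ?_⟩
      simpa only [cutSum_false, sub_zero] using hcut
    obtain ⟨_, ⟨U, S, hU, hS, rfl⟩, hUS⟩ := exists_lt_of_lt_csSup
      (s := {a | ∃ U S : Set I, MeasurableSet U ∧ MeasurableSet S ∧ a = |∫ p in U ×ˢ S, W p|})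
      ⟨_, ∅, ∅, MeasurableSet.empty, MeasurableSet.empty, rfl⟩ (not_le.1 hcut)
    -- The height is fixed at `±e` rather than taken to be the mean over the rectangle. The energy
    -- still drops by `e ^ 2`, and only a sign has to be recorded.
    obtain ⟨s, hs⟩ : ∃ s : Bool, (if s then e else -e) ^ 2 ≤
        (if s then e else -e) * ∫ p in U ×ˢ S, W p := by
      rcases lt_abs.1 hUS with h' | h'
      · exact ⟨true, by simp only [if_true]; nlinarith⟩
      · exact ⟨false, by simp only [Bool.false_eq_true, if_false]; nlinarith⟩
    have hs2 : (if s then e else -e) ^ 2 = e ^ 2 := by cases s <;> simp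
    have hUSm := hU.prod hS
    have hdec := integral_sub_indicator_sq_le hW hB hUSm hs
    rw [hs2] at hdec
    set d : ℝ := if s then e else -e with hd
    have hdabs : |d| = e := by rw [← abs_of_pos he]; exact (sq_eq_sq_iff_abs_eq_abs _ _).1 hs2
    obtain ⟨τ, a, b, ha, hb, hab⟩ := ih
      (W := fun p => W p - (U ×ˢ S).indicator (fun _ => d) p)
      (hW.sub (measurable_const.indicator hUSm)) (B := B + e)
      (fun p => (abs_sub _ _).trans (add_le_add (hB p) (by
        by_cases hp : p ∈ U ×ˢ S
        · rw [indicator_of_mem hp, hdabs]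
        · rw [indicator_of_notMem hp]; simpa using he.le)))
      (by push_cast at h; linarith)
    have hmeas {A : Set I} (hA : MeasurableSet A) {c : I → Fin n → Bool} (hc : Measurable c) :
        Measurable fun x => (Fin.cons (decide (x ∈ A)) (c x) : Fin (n + 1) → Bool) := by
      refine measurable_pi_iff.2 fun i => ?_
      refine Fin.cases ?_ (fun j => ?_) i
      · simp only [Fin.cons_zero]
        refine measurable_to_bool ?_
        convert hA using 1
        ext x; simp
      · simp only [Fin.cons_succ]
        exact (measurable_pi_apply j).comp hc
    refine ⟨Fin.cons s τ, fun x => Fin.cons (decide (x ∈ U)) (a x),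
      fun x => Fin.cons (decide (x ∈ S)) (b x), hmeas hU ha, hmeas hS hb, ?_⟩
    refine le_of_eq_of_le ?_ hab
    congr 1
    funext p
    rw [cutSum_cons, ← sub_sub]
    simp [indicator_apply, mem_prod, hd]

/-! ### Encoding graphon-signals by finitely many codes -/

theorem kernelCutNorm_pull (φ : CoNullBijection) {W : I × I → ℝ} (hW : Integrable W) :
    kernelCutNorm (kernelPull φ W) = kernelCutNorm W := by
  have h := cutNorm_pull φ hW (integrable_zero I ℝ volume)
  have h0 : signalPull φ 0 = 0 := indicator_zero _ _
  change cutNorm (kernelPull φ W) (signalPull φ 0) = cutNorm W 0 at h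
  rw [h0] at h
  exact add_right_cancel h

theorem kernelCutNorm_add_sub_le {A F B : I × I → ℝ} (hA : Integrable A) (hF : Integrable F)
    (hB : Integrable B) :
    kernelCutNorm (A + F - B) ≤ kernelCutNorm A + kernelCutNorm F + kernelCutNorm B := by
  refine kernelCutNorm_le fun U S hU hS => ?_
  have h : ∫ p in U ×ˢ S, (A + F - B) p =
      (∫ p in U ×ˢ S, A p) + (∫ p in U ×ˢ S, F p) - ∫ p in U ×ˢ S, B p := by
    rw [integral_sub' (hA.add hF).integrableOn hB.integrableOn,
      integral_add' hA.integrableOn hF.integrableOn]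
  rw [h]
  exact (abs_sub _ _).trans (add_le_add ((abs_add_le _ _).trans
    (add_le_add (le_kernelCutNorm hA hU hS) (le_kernelCutNorm hF hU hS)))
    (le_kernelCutNorm hB hU hS))

/-- The support lies in the two strips `N × [0,1]` and `[0,1] × N`, each of measure `μ(N)`. -/
theorem kernelCutNorm_le_of_eq_zero_off {F : I × I → ℝ} (hF : Measurable F) {C : ℝ}
    (hC : ∀ p, |F p| ≤ C) {N : Set I} (hN : MeasurableSet N)
    (h0 : ∀ x y, x ∉ N → y ∉ N → F (x, y) = 0) :
    kernelCutNorm F ≤ C * (2 * volume.real N) := by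
  have hC0 : 0 ≤ C := (abs_nonneg _).trans (hC (0, 0))
  have i1 : Integrable fun p : I × I => (Prod.fst ⁻¹' N).indicator (fun _ => C) p :=
    (integrable_const C).indicator (measurable_fst hN)
  have i2 : Integrable fun p : I × I => (Prod.snd ⁻¹' N).indicator (fun _ => C) p :=
    (integrable_const C).indicator (measurable_snd hN)
  have v1 : volume.real (Prod.fst ⁻¹' N : Set (I × I)) = volume.real N :=
    (measurePreserving_fst (μ := (volume : Measure I)) (ν := (volume : Measure I))
      ).measureReal_preimage hN.nullMeasurableSet
  have v2 : volume.real (Prod.snd ⁻¹' N : Set (I × I)) = volume.real N :=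
    (measurePreserving_snd (μ := (volume : Measure I)) (ν := (volume : Measure I))
      ).measureReal_preimage hN.nullMeasurableSet
  refine kernelCutNorm_le fun U S _ _ => ?_
  calc |∫ p in U ×ˢ S, F p| ≤ ∫ p, |F p| := abs_setIntegral_le (integrable_of_abs_le hF hC) _
    _ ≤ ∫ p : I × I, ((Prod.fst ⁻¹' N).indicator (fun _ => C) p +
          (Prod.snd ⁻¹' N).indicator (fun _ => C) p) := by
        refine integral_mono (integrable_of_abs_le hF hC).abs (i1.add i2) fun p => ?_
        have hn1 : 0 ≤ (Prod.fst ⁻¹' N).indicator (fun _ => C) p :=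
          indicator_nonneg (fun _ _ => hC0) _
        have hn2 : 0 ≤ (Prod.snd ⁻¹' N).indicator (fun _ => C) p :=
          indicator_nonneg (fun _ _ => hC0) _
        change |F p| ≤ _
        by_cases h1 : p.1 ∈ N
        · rw [indicator_of_mem (show p ∈ Prod.fst ⁻¹' N from h1)]
          linarith [hC p]
        by_cases h2 : p.2 ∈ N
        · rw [indicator_of_mem (show p ∈ Prod.snd ⁻¹' N from h2)]
          linarith [hC p]
        rw [show F p = 0 from h0 p.1 p.2 h1 h2, abs_zero]
        exact add_nonneg hn1 hn2
    _ = C * (2 * volume.real N) := by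
        rw [integral_add i1 i2, integral_indicator (measurable_fst hN),
          integral_indicator (measurable_snd hN), setIntegral_const, setIntegral_const, v1, v2]
        simp only [smul_eq_mul]; ring

theorem signalCutNorm_le_of_le_off {F : I → ℝ} (hF : Measurable F) {C ρ : ℝ} (hρ : 0 ≤ ρ)
    (hC : ∀ x, |F x| ≤ C) {N : Set I} (hN : MeasurableSet N) (h0 : ∀ x ∉ N, |F x| ≤ ρ) :
    signalCutNorm F ≤ ρ + C * volume.real N := by
  have i1 : Integrable (N.indicator fun _ => C) (volume : Measure I) :=
    (integrable_const C).indicator hN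
  refine signalCutNorm_le fun S _ => ?_
  calc |∫ x in S, F x| ≤ ∫ x, |F x| := abs_setIntegral_le (integrable_of_abs_le hF hC) _
    _ ≤ ∫ x, (ρ + N.indicator (fun _ => C) x) := by
        refine integral_mono (integrable_of_abs_le hF hC).abs ((integrable_const ρ).add i1)
          fun x => ?_
        change |F x| ≤ _
        by_cases h1 : x ∈ N
        · rw [indicator_of_mem h1]; linarith [hC x]
        · rw [indicator_of_notMem h1, add_zero]; exact h0 x h1
    _ = ρ + C * volume.real N := by
        rw [integral_add (integrable_const ρ) i1, integral_indicator hN, setIntegral_const]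
        simp [mul_comm]

/-- The data recorded about a point of `[0,1]`: the level of the signal, and the sets of a cut
decomposition that contain the point. -/
abbrev Part (n : ℕ) : Type := Fin (n + 1) × (Fin n → Bool) × (Fin n → Bool)

theorem card_part (n : ℕ) : Fintype.card (Part n) = (n + 1) * 4 ^ n := by
  simp only [Fintype.card_prod, Fintype.card_fin, Fintype.card_pi, Fintype.card_bool,
    Finset.prod_const, Finset.card_univ, ← mul_pow]
  norm_num

/-- Subtracting `1/2` bounds the kernel by `1/2` and its energy by `1/4`, a quarter of the bound
available for `W` itself. The signal level runs over `0, …, n`; the value `n` occurs exactly where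
the signal equals `r`. -/
theorem exists_part_approx {r : ℝ} (hr : 0 < r) {e : ℝ} (he : 0 < e) {n : ℕ}
    (hn : 1 / 4 < n * e ^ 2) (a : GraphonSignal r) :
    ∃ (τ : Fin n → Bool) (p : I → Part n), Measurable p ∧
      kernelCutNorm (fun z => a.graphon.toFun z - 1 / 2 - cutSum e τ (p z.1).2.1 (p z.2).2.2) ≤ e ∧
      ∀ x, ((p x).1 : ℕ) = ⌊(a.signal.toFun x + r) * n / (2 * r)⌋₊ := by
  have hW : Measurable fun z => a.graphon.toFun z - 1 / 2 := a.graphon.measurable.sub_const _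
  have hB : ∀ z, |a.graphon.toFun z - 1 / 2| ≤ 1 / 2 := fun z => by
    have := a.graphon.mem_Icc z
    rw [abs_le]; constructor <;> linarith [this.1, this.2]
  have hsq : ∫ z, (a.graphon.toFun z - 1 / 2) ^ 2 < n * e ^ 2 := by
    refine lt_of_le_of_lt ?_ hn
    have : ∫ z, (a.graphon.toFun z - 1 / 2) ^ 2 ≤ ∫ _ : I × I, (1 / 4 : ℝ) := by
      have hle : ∀ z, (a.graphon.toFun z - 1 / 2) ^ 2 ≤ (1 / 4 : ℝ) := fun z => by
        have := sq_le_sq' (abs_le.1 (hB z)).1 (abs_le.1 (hB z)).2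
        linarith
      refine integral_mono (integrable_of_abs_le (hW.pow_const 2) (B := 1 / 4) fun z => ?_)
        (integrable_const _) hle
      rw [abs_of_nonneg (sq_nonneg _)]; exact hle z
    simpa using this
  obtain ⟨τ, s, t, hs, ht, hst⟩ := exists_cutSum_approx he n hW hB hsq
  have hlev (x : I) : ⌊(a.signal.toFun x + r) * n / (2 * r)⌋₊ < n + 1 := by
    have := abs_le.1 (a.signal.abs_le x)
    have h1 : (a.signal.toFun x + r) * n / (2 * r) ≤ n := by
      rw [div_le_iff₀ (by positivity), mul_comm]
      exact mul_le_mul_of_nonneg_left (by linarith) (by positivity)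
    exact Nat.lt_succ_of_le (Nat.floor_le_of_le h1)
  have hm : Measurable fun x => (⟨_, hlev x⟩ : Fin (n + 1)) := by
    have h1 : Measurable fun x => ⌊(a.signal.toFun x + r) * n / (2 * r)⌋₊ :=
      Nat.measurable_floor.comp (((a.signal.measurable.add_const r).mul_const _).div_const _)
    refine measurable_to_countable' fun i => ?_
    convert h1 (measurableSet_singleton (i : ℕ)) using 1
    ext x; simp [Fin.ext_iff]
  exact ⟨τ, fun x => (⟨_, hlev x⟩, s x, t x), hm.prodMk (hs.prodMk ht), hst, fun x => rfl⟩

theorem abs_sub_le_of_floor_eq {u v : ℝ} (hu : 0 ≤ u) (hv : 0 ≤ v) (h : ⌊u⌋₊ = ⌊v⌋₊) :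
    |u - v| ≤ 1 := by
  have h1 := Nat.floor_le hu
  have h2 := Nat.lt_floor_add_one u
  have h3 := Nat.floor_le hv
  have h4 := Nat.lt_floor_add_one v
  rw [h] at h1 h2
  rw [abs_le]; constructor <;> linarith

/-- Two graphon-signals with the same signs in their cut decompositions are as close as their
partitions can be matched. -/
theorem cutDistance_le_of_matching {r : ℝ} (hr : 0 < r) {e : ℝ} (he : 0 < e) {n : ℕ} (hn : 0 < n)
    {a b : GraphonSignal r} {τ : Fin n → Bool} {p q : I → Part n} (hp : Measurable p)
    (hq : Measurable q)
    (hpK : kernelCutNorm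
      (fun z => a.graphon.toFun z - 1 / 2 - cutSum e τ (p z.1).2.1 (p z.2).2.2) ≤ e)
    (hqK : kernelCutNorm
      (fun z => b.graphon.toFun z - 1 / 2 - cutSum e τ (q z.1).2.1 (q z.2).2.2) ≤ e)
    (hpl : ∀ x, ((p x).1 : ℕ) = ⌊(a.signal.toFun x + r) * n / (2 * r)⌋₊)
    (hql : ∀ x, ((q x).1 : ℕ) = ⌊(b.signal.toFun x + r) * n / (2 * r)⌋₊)
    (φ : CoNullBijection) {δ : ℝ} (hδ : volume.real {x | p x ≠ q (φ.ext x)} ≤ δ) :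
    cutDistance a b ≤ 2 * e + 2 * r / n + (4 * n * e + 2 * r) * δ := by
  have hn' : (0 : ℝ) < n := by exact_mod_cast hn
  set N : Set I := {x | p x ≠ q (φ.ext x)} with hNdef
  have hN : MeasurableSet N := (measurableSet_eq_fun hp (hq.comp φ.measurable_ext)).compl
  have hcs {s : I → Part n} (hs : Measurable s) :
      Measurable fun z : I × I => cutSum e τ (s z.1).2.1 (s z.2).2.2 :=
    measurable_cutSum e τ hs.snd.fst hs.snd.snd
  have hint {s : I → Part n} (hs : Measurable s) :
      Integrable fun z : I × I => cutSum e τ (s z.1).2.1 (s z.2).2.2 :=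
    integrable_of_abs_le (hcs hs) fun z => abs_cutSum_le he.le _ _ _
  have hres {s : I → Part n} (hs : Measurable s) (c : GraphonSignal r) :
      Integrable fun z : I × I =>
        c.graphon.toFun z - 1 / 2 - cutSum e τ (s z.1).2.1 (s z.2).2.2 :=
    (c.graphon.integrable.sub (integrable_const _)).sub (hint hs)
  have hqφ : Measurable (q ∘ φ.ext) := hq.comp φ.measurable_ext
  let F : I × I → ℝ := fun z => cutSum e τ (p z.1).2.1 (p z.2).2.2 -
    cutSum e τ (q (φ.ext z.1)).2.1 (q (φ.ext z.2)).2.2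
  have hFm : Measurable F := (hcs hp).sub (hcs hqφ)
  have hFb : ∀ z, |F z| ≤ 2 * (n * e) := fun z => by
    refine (abs_sub _ _).trans ?_
    rw [two_mul]
    exact add_le_add (abs_cutSum_le he.le _ _ _) (abs_cutSum_le he.le _ _ _)
  have hF := kernelCutNorm_le_of_eq_zero_off hFm hFb hN fun x y hx hy => by
    have hx' : p x = q (φ.ext x) := not_not.1 hx
    have hy' : p y = q (φ.ext y) := not_not.1 hy
    simp only [F, hx', hy', sub_self]
  have hkernel : kernelCutNorm (a.graphon.toFun - kernelPull φ b.graphon.toFun) ≤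
      e + 2 * (n * e) * (2 * δ) + e := by
    -- The constants `1/2` cancel in the difference. What remains is the two regularity errors and
    -- `F`, which compares the same signed sum on the two matched partitions and vanishes where the
    -- parts agree.
    have hae : a.graphon.toFun - kernelPull φ b.graphon.toFun =ᵐ[volume]
        (fun z => a.graphon.toFun z - 1 / 2 - cutSum e τ (p z.1).2.1 (p z.2).2.2) + F -
        kernelPull φ
          (fun z => b.graphon.toFun z - 1 / 2 - cutSum e τ (q z.1).2.1 (q z.2).2.2) := by
      filter_upwards [kernelPull_ae φ b.graphon.toFun, kernelPull_ae φ
        (fun z => b.graphon.toFun z - 1 / 2 - cutSum e τ (q z.1).2.1 (q z.2).2.2)] with z h1 h2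
      simp only [Pi.sub_apply, Pi.add_apply, h1, h2, Function.comp, Prod.map, F]
      ring
    rw [kernelCutNorm_congr hae]
    refine (kernelCutNorm_add_sub_le (hres hp a) (integrable_of_abs_le hFm hFb)
      (integrable_kernelPull φ (hres hq b))).trans ?_
    rw [kernelCutNorm_pull φ (hres hq b)]
    have : 2 * (n * e) * (2 * volume.real N) ≤ 2 * (n * e) * (2 * δ) := by gcongr
    linarith
  have hsignal : signalCutNorm (a.signal.toFun - signalPull φ b.signal.toFun) ≤
      2 * r / n + 2 * r * δ := by
    have hae : a.signal.toFun - signalPull φ b.signal.toFun =ᵐ[volume]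
        fun x => a.signal.toFun x - b.signal.toFun (φ.ext x) := by
      filter_upwards [signalPull_ae φ b.signal.toFun] with x h1
      simp only [Pi.sub_apply, h1, Function.comp]
    rw [signalCutNorm_congr hae]
    refine (signalCutNorm_le_of_le_off (C := 2 * r) (ρ := 2 * r / n)
      (a.signal.measurable.sub (b.signal.measurable.comp φ.measurable_ext)) (by positivity)
      (fun x => ?_) hN (fun x hx => ?_)).trans ?_
    · refine (abs_sub _ _).trans ?_
      rw [two_mul]
      exact add_le_add (a.signal.abs_le _) (b.signal.abs_le _)
    · have hx' : p x = q (φ.ext x) := not_not.1 hx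
      have h := hpl x
      rw [hx', hql] at h
      have ha := abs_le.1 (a.signal.abs_le x)
      have hb := abs_le.1 (b.signal.abs_le (φ.ext x))
      have h2 := abs_sub_le_of_floor_eq
        (div_nonneg (mul_nonneg (by linarith : 0 ≤ b.signal.toFun (φ.ext x) + r) hn'.le)
          (by positivity : 0 ≤ 2 * r))
        (div_nonneg (mul_nonneg (by linarith : 0 ≤ a.signal.toFun x + r) hn'.le)
          (by positivity : 0 ≤ 2 * r)) h
      rw [abs_sub_comm] at h2
      have h3 : a.signal.toFun x - b.signal.toFun (φ.ext x) =
          ((a.signal.toFun x + r) * n / (2 * r) -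
            (b.signal.toFun (φ.ext x) + r) * n / (2 * r)) * (2 * r / n) := by
        field_simp; ring
      change |a.signal.toFun x - b.signal.toFun (φ.ext x)| ≤ _
      rw [h3, abs_mul, abs_of_nonneg (by positivity : 0 ≤ 2 * r / (n : ℝ))]
      exact mul_le_of_le_one_left (by positivity) h2
    · gcongr
  refine (cutDistance_le a b φ).trans ((add_le_add hkernel hsignal).trans_eq ?_)
  ring

/-- Graphon-signals can be encoded by signs and rounded cumulative measures, so that two
graphon-signals with the same code are close. -/
theorem exists_code {r : ℝ} (hr : 0 < r) {e : ℝ} (he : 0 < e) {n M : ℕ} (hn0 : 0 < n)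
    (hM : 0 < M) (hn : 1 / 4 < n * e ^ 2) :
    ∃ code : GraphonSignal r → (Fin n → Bool) × (Fin ((n + 1) * 4 ^ n) → Fin (M + 1)),
      ∀ a b, code a = code b → cutDistance a b ≤
        2 * e + 2 * r / n + (4 * n * e + 2 * r) * (((n + 1) * 4 ^ n : ℕ) / M) := by
  have hM' : (0 : ℝ) < M := by exact_mod_cast hM
  choose τ p hp hK hl using fun a : GraphonSignal r => exists_part_approx hr he hn a
  -- Any enumeration of the parts works: the order serves only to define cumulative measures, the
  -- quantity in which matching costs are expressed.
  let E : Part n ≃ Fin ((n + 1) * 4 ^ n) := Fintype.equivFinOfCardEq (card_part n)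
  have hE (a) : Measurable fun x => E (p a x) := (measurable_of_finite E).comp (hp a)
  have hfl (a : GraphonSignal r) (i) :
      ⌊volume.real {x | E (p a x) ≤ i} * M⌋₊ < M + 1 := by
    refine Nat.lt_succ_of_le (Nat.floor_le_of_le ?_)
    exact mul_le_of_le_one_left hM'.le measureReal_le_one
  refine ⟨fun a => (τ a, fun i => ⟨_, hfl a i⟩), fun a b hab => ?_⟩
  obtain ⟨h1, h2⟩ := Prod.ext_iff.1 hab
  simp only at h1 h2
  obtain ⟨φ, hφ⟩ := exists_matching (hE a) (hE b)
  refine cutDistance_le_of_matching hr he hn0 (hp a) (hp b) (hK a) (h1 ▸ hK b) (hl a) (hl b) φ ?_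
  have hset : {x | p a x ≠ p b (φ.ext x)} = {x | E (p a x) ≠ E (p b (φ.ext x))} := by
    ext x; simp
  rw [hset]
  refine hφ.trans ?_
  have hterm : ∀ i ∈ (Finset.univ : Finset (Fin ((n + 1) * 4 ^ n))),
      |volume.real {x | E (p a x) ≤ i} - volume.real {x | E (p b x) ≤ i}| ≤ 1 / M := by
    intro i _
    have h3 : ⌊volume.real {x | E (p a x) ≤ i} * M⌋₊ = ⌊volume.real {x | E (p b x) ≤ i} * M⌋₊ :=
      congrArg Fin.val (congrFun h2 i)
    have h4 := abs_sub_le_of_floor_eq (by positivity) (by positivity) h3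
    rw [← sub_mul, abs_mul, abs_of_pos hM'] at h4
    rwa [le_div_iff₀ hM']
  refine (Finset.sum_le_card_nsmul _ _ _ hterm).trans_eq ?_
  rw [Finset.card_univ, Fintype.card_fin, nsmul_eq_mul, mul_one_div]

/-! ### Covering numbers -/

/-- One representative of each attained code is a centre; indices that no code reaches receive an
arbitrary centre. -/
theorem exists_cover_of_code {X C : Type*} [PseudoMetricSpace X] [Nonempty X] [Fintype C]
    {ε : ℝ} (code : X → C) (h : ∀ a b, code a = code b → dist a b < ε) {N : ℕ}
    (hN : Fintype.card C ≤ N) :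
    ∃ center : Fin N → SeparationQuotient X, (⋃ i, Metric.ball (center i) ε) = univ := by
  obtain ⟨g⟩ : Nonempty (C ↪ Fin N) := Function.Embedding.nonempty_of_card_le (by simpa using hN)
  refine ⟨fun i => SeparationQuotient.mk (Function.invFun (g ∘ code) i), eq_univ_of_forall ?_⟩
  intro y
  obtain ⟨x, rfl⟩ := SeparationQuotient.surjective_mk y
  refine mem_iUnion.2 ⟨g (code x), ?_⟩
  rw [Metric.mem_ball, SeparationQuotient.dist_mk]
  have : (g ∘ code) (Function.invFun (g ∘ code) (g (code x))) = g (code x) :=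
    Function.invFun_eq ⟨x, rfl⟩
  exact h _ _ (g.injective this).symm

/-- For counting codes: each of the `(n+1)4^n` rounded measures takes at most `4n+1` bits, and the
signs take `n` more. Multiplied by `4^n`, this inequality bounds the total by `8^n` bits. -/
theorem quadratic_le_two_pow {n : ℕ} (hn : 9 ≤ n) : (4 * n + 1) * (n + 1) + n ≤ 2 ^ n := by
  induction n, hn using Nat.le_induction with
  | base => norm_num
  | succ n hn ih => rw [pow_succ]; nlinarith

theorem cubic_le_four_pow {n : ℕ} (hn : 9 ≤ n) : 40 * n ^ 2 * (n + 1) ≤ 4 ^ n := by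
  induction n, hn using Nat.le_induction with
  | base => norm_num
  | succ n hn ih =>
    have : (n + 1) ^ 2 * (n + 1 + 1) ≤ n ^ 2 * (n + 1) * 4 := by nlinarith
    rw [pow_succ 4]
    linarith

theorem card_codes_le {n k : ℕ} (hn : 9 ≤ n) (hk : 8 ^ n ≤ k ^ 2) :
    Fintype.card ((Fin n → Bool) × (Fin ((n + 1) * 4 ^ n) → Fin (16 ^ n + 1))) ≤ 2 ^ k ^ 2 := by
  simp only [Fintype.card_prod, Fintype.card_fin, Fintype.card_pi, Fintype.card_bool,
    Finset.prod_const, Finset.card_univ]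
  have h1 : 16 ^ n + 1 ≤ 2 ^ (4 * n + 1) := by
    have h : (16 : ℕ) ^ n = 2 ^ (4 * n) := by rw [pow_mul]; norm_num
    have : 1 ≤ 2 ^ (4 * n) := Nat.one_le_two_pow
    rw [h, pow_succ]; omega
  calc 2 ^ n * (16 ^ n + 1) ^ ((n + 1) * 4 ^ n)
      ≤ 2 ^ n * (2 ^ (4 * n + 1)) ^ ((n + 1) * 4 ^ n) := by gcongr
    _ = 2 ^ (n + (4 * n + 1) * ((n + 1) * 4 ^ n)) := by rw [← pow_mul, ← pow_add]
    _ ≤ 2 ^ k ^ 2 := by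
        refine Nat.pow_le_pow_right (by norm_num) (le_trans ?_ hk)
        have h2 : (8 : ℕ) ^ n = 2 ^ n * 4 ^ n := by rw [← mul_pow]; norm_num
        have h3 : 1 ≤ 4 ^ n := Nat.one_le_pow _ _ (by norm_num)
        rw [h2]
        refine le_trans ?_ (Nat.mul_le_mul_right _ (quadratic_le_two_pow hn))
        nlinarith

theorem nonempty_graphonSignal {r : ℝ} (hr : 0 ≤ r) : Nonempty (GraphonSignal r) :=
  ⟨⟨⟨fun _ => 0, measurable_const, fun _ => by simp, fun _ _ => rfl⟩,
    ⟨fun _ => 0, measurable_const, fun _ => by simpa using hr⟩⟩⟩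

/-- The error budget is `2e = 9ε/10` for the two regularity errors, less than `ε/20` for the signal
levels and at most `ε/20` for the mismatched set. -/
theorem exists_cover {r : ℝ} (hr : 0 < r) {ε : ℝ} (hε : 0 < ε) (hε3 : ε < 1 / 3)
    (hεr : ε < 1 / (40 * r)) {k : ℕ} (hk : (2 : ℝ) ^ (9 / (4 * ε ^ 2)) ≤ k) :
    ∃ center : Fin (2 ^ (k ^ 2)) → QuotientSpace r, (⋃ i, Metric.ball (center i) ε) = univ := by
  have := nonempty_graphonSignal hr.le
  have hrε : r * ε < 1 / 40 := by
    rw [lt_div_iff₀ (by positivity)] at hεr; linarith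
  have hε2 : 0 < ε ^ 2 := by positivity
  have hε9 : ε ^ 2 < 1 / 9 := by nlinarith
  -- This is `1/(4e²)` for `e = 9ε/20`, the threshold that the number `n` of rectangles must exceed.
  set u : ℝ := 1 / (81 / 100 * ε ^ 2) with hu
  have huε : u * ε ^ 2 = 100 / 81 := by rw [hu]; field_simp
  have hu0 : 0 < u := by rw [hu]; positivity
  have hu9 : 9 < u := by nlinarith
  obtain ⟨n, hn⟩ : ∃ n : ℕ, n = ⌊u⌋₊ + 1 := ⟨_, rfl⟩
  have hun : u < n := by rw [hn]; push_cast; exact Nat.lt_floor_add_one u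
  have hnu : (n : ℝ) ≤ u + 1 := by
    rw [hn]; push_cast; linarith [Nat.floor_le hu0.le]
  have hn9 : 9 ≤ n := by
    have : (9 : ℝ) < n := hu9.trans hun
    exact_mod_cast this.le
  have hn9' : (9 : ℝ) ≤ n := by exact_mod_cast hn9
  have hn0 : (0 : ℝ) < n := by linarith
  have hnε : 100 / 81 < n * ε ^ 2 := by rw [← huε]; gcongr
  have hone : 1 ≤ n * ε := by
    by_contra! h
    nlinarith
  obtain ⟨code, hcode⟩ := exists_code hr (e := 9 / 20 * ε) (by positivity) (n := n)
    (M := 16 ^ n) (by omega) (by positivity) (by nlinarith)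
  refine exists_cover_of_code code (fun a b hab => lt_of_le_of_lt (hcode a b hab) ?_)
    (card_codes_le hn9 ?_)
  · have h1 : 2 * r / n < 5 / 100 * ε := by
      rw [div_lt_iff₀ hn0]
      nlinarith
    have h2 : (4 * n * (9 / 20 * ε) + 2 * r) ≤ 2 * n := by nlinarith
    have h3 : (((n + 1) * 4 ^ n : ℕ) : ℝ) / ((16 ^ n : ℕ) : ℝ) = (n + 1) / 4 ^ n := by
      have : (16 : ℝ) ^ n = 4 ^ n * 4 ^ n := by rw [← mul_pow]; norm_num
      push_cast
      rw [this]; field_simp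
    have h4 : (40 * n ^ 2 * (n + 1) : ℝ) ≤ 4 ^ n := by exact_mod_cast cubic_le_four_pow hn9
    have h5 : (4 * n * (9 / 20 * ε) + 2 * r) * ((n + 1) / 4 ^ n) ≤ 5 / 100 * ε := by
      refine (mul_le_mul_of_nonneg_right h2 (by positivity)).trans ?_
      rw [← mul_div_assoc, div_le_iff₀ (by positivity)]
      -- The factor `n * ε ≥ 1` supplies the power of `ε` wanted on the right, at the price of one
      -- more power of `n`.
      calc 2 * (n : ℝ) * (n + 1) ≤ 2 * n * (n + 1) * (n * ε) :=
            le_mul_of_one_le_right (by positivity) hone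
        _ = 5 / 100 * ε * (40 * n ^ 2 * (n + 1)) := by ring
        _ ≤ _ := by gcongr
    rw [h3]
    linarith
  · have h1 : (8 : ℝ) ^ n ≤ (2 : ℝ) ^ (9 / (4 * ε ^ 2)) * (2 : ℝ) ^ (9 / (4 * ε ^ 2)) := by
      rw [← Real.rpow_add (by norm_num), ← Real.rpow_natCast, show (8 : ℝ) = 2 ^ (3 : ℝ) by norm_num,
        ← Real.rpow_mul (by norm_num)]
      refine Real.rpow_le_rpow_of_exponent_le (by norm_num) ?_
      -- The exponent of `k ^ 2` is at least `3.645 u`, whereas `8 ^ n` has exponent `3n ≤ 3u + 3`;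
      -- `u > 9` leaves room.
      have : 9 / (4 * ε ^ 2) + 9 / (4 * ε ^ 2) = 729 / 200 * u := by rw [hu]; field_simp; norm_num
      rw [this]
      linarith
    have h2 : (8 : ℝ) ^ n ≤ (k : ℝ) ^ 2 := by
      rw [sq]
      exact h1.trans (by gcongr)
    exact_mod_cast h2

/-! ### Completeness -/

section Complete

open Filter Topology

/-- A uniformly bounded sequence of functions has a weak limit along a non-principal ultrafilter. -/
theorem exists_weak_limit {α : Type*} [MeasurableSpace α] {μ : Measure α} [IsFiniteMeasure μ]
    {l u : ℝ} (hlu : l ≤ u) {F : ℕ → α → ℝ} (hF : ∀ n, Measurable (F n))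
    (hb : ∀ n x, F n x ∈ Icc l u) :
    ∃ G : α → ℝ, Measurable G ∧ (∀ x, G x ∈ Icc l u) ∧ ∀ A, MeasurableSet A →
      Tendsto (fun n => ∫ x in A, F n x ∂μ) (hyperfilter ℕ) (𝓝 (∫ x in A, G x ∂μ)) := by
  have hbound (n) (x) : ‖F n x‖ ≤ max |l| |u| := abs_le_max_abs_abs (hb n x).1 (hb n x).2
  have hmem (n) : MemLp (F n) 2 μ :=
    MemLp.of_bound (hF n).aestronglyMeasurable _ (Eventually.of_forall (hbound n))
  let v : ℕ → Lp ℝ 2 μ := fun n => (hmem n).toLp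
  obtain ⟨R, hR⟩ : ∃ R, ∀ n, ‖v n‖ ≤ R := ⟨_, fun n => Lp.norm_le_of_ae_bound
    ((abs_nonneg l).trans (le_max_left |l| |u|)) (by
      filter_upwards [(hmem n).coeFn_toLp] with x hx
      rw [hx]; exact hbound n x)⟩
  -- Banach–Alaoglu in `L²`, identified with its dual by Riesz. An ultrafilter gives a limit without
  -- extracting subsequences, and the same ultrafilter serves kernels and signals alike.
  let w : ℕ → WeakDual ℝ (Lp ℝ 2 μ) := fun n =>
    StrongDual.toWeakDual (InnerProductSpace.toDual ℝ (Lp ℝ 2 μ) (v n))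
  obtain ⟨ℓ, -, hℓ⟩ := (WeakDual.isCompact_closedBall (𝕜 := ℝ) (E := Lp ℝ 2 μ) 0 R
    ).ultrafilter_le_nhds ((hyperfilter ℕ).map w) (by
      refine tendsto_principal.2 (Eventually.of_forall fun n => ?_)
      change InnerProductSpace.toDual ℝ (Lp ℝ 2 μ) (v n) ∈ Metric.closedBall 0 R
      rw [mem_closedBall_zero_iff, LinearIsometryEquiv.norm_map]
      exact hR n)
  obtain ⟨g, hg⟩ := (InnerProductSpace.toDual ℝ (Lp ℝ 2 μ)).surjective (WeakDual.toStrongDual ℓ)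
  have hlim (A : Set α) (hA : MeasurableSet A) :
      Tendsto (fun n => ∫ x in A, F n x ∂μ) (hyperfilter ℕ) (𝓝 (∫ x in A, g x ∂μ)) := by
    let z : Lp ℝ 2 μ := indicatorConstLp 2 hA (measure_ne_top μ A) 1
    have h1 : Tendsto (fun n => w n z) (hyperfilter ℕ) (𝓝 (ℓ z)) :=
      ((WeakDual.eval_continuous z).tendsto ℓ).comp hℓ
    have h2 (y : Lp ℝ 2 μ) : inner ℝ y z = ∫ x in A, y x ∂μ := by
      rw [real_inner_comm]; exact L2.inner_indicatorConstLp_one hA _ y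
    have h3 : ℓ z = ∫ x in A, g x ∂μ := by
      rw [← h2]
      exact (congrArg (fun f : StrongDual ℝ (Lp ℝ 2 μ) => f z) hg).symm
    have h4 (n) : w n z = ∫ x in A, F n x ∂μ := by
      change inner ℝ (v n) z = _
      rw [h2]
      exact integral_congr_ae (ae_restrict_of_ae (hmem n).coeFn_toLp)
    simpa only [h3, h4] using h1
  have hgi : Integrable g μ := (Lp.memLp g).integrable (by norm_num)
  have hFi (n) : Integrable (F n) μ := integrable_of_abs_le (hF n) (hbound n)
  have hlg : (fun _ => l) ≤ᵐ[μ] g :=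
    ae_le_of_forall_setIntegral_le (integrable_const l) hgi fun A hA _ =>
      ge_of_tendsto (hlim A hA) (Eventually.of_forall fun n =>
        setIntegral_mono (integrable_const l).integrableOn (hFi n).integrableOn
          fun x => (hb n x).1)
  have hgu : g ≤ᵐ[μ] fun _ => u :=
    ae_le_of_forall_setIntegral_le hgi (integrable_const u) fun A hA _ =>
      le_of_tendsto (hlim A hA) (Eventually.of_forall fun n =>
        setIntegral_mono (hFi n).integrableOn (integrable_const u).integrableOn
          fun x => (hb n x).2)
  -- The weak limit obeys the bounds only almost everywhere; truncation makes them hold at every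
  -- point, as graphons and signals require.
  refine ⟨fun x => max l (min u (g x)),
    measurable_const.max (measurable_const.min (Lp.stronglyMeasurable g).measurable),
    fun x => ⟨le_max_left _ _, max_le hlu (min_le_left _ _)⟩, fun A hA => ?_⟩
  have : ∫ x in A, max l (min u (g x)) ∂μ = ∫ x in A, g x ∂μ := by
    refine integral_congr_ae (ae_restrict_of_ae ?_)
    filter_upwards [hlg, hgu] with x h1 h2
    rw [min_eq_right h2, max_eq_right h1]
  rw [this]
  exact hlim A hA

/-- Geometric increments make the sequence converge, necessarily to the ultrafilter limit, and the
tail sums to `2 * (1 / 2) ^ n`. The bound depends only on `n`, hence is uniform over the sets tested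
in a cut norm. -/
theorem abs_sub_le_of_hyperfilter_limit {s : ℕ → ℝ} {L : ℝ}
    (hs : ∀ n, |s n - s (n + 1)| ≤ (1 / 2) ^ n) (hL : Tendsto s (hyperfilter ℕ) (𝓝 L)) (n : ℕ) :
    |s n - L| ≤ 2 * (1 / 2) ^ n := by
  have hs' : ∀ n, dist (s n) (s (n + 1)) ≤ 1 * (1 / 2) ^ n := fun n => by
    rw [Real.dist_eq, one_mul]; exact hs n
  obtain ⟨L', hL'⟩ := cauchySeq_tendsto_of_complete (cauchySeq_of_le_geometric _ _ (by norm_num) hs')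
  have : L = L' := tendsto_nhds_unique hL (hL'.mono_left Nat.hyperfilter_le_atTop)
  have h := dist_le_of_le_geometric_of_tendsto (1 / 2) 1 (by norm_num) hs' hL' n
  rw [Real.dist_eq, ← this] at h
  refine h.trans_eq ?_
  ring

theorem setIntegral_swap (W : I × I → ℝ) (U S : Set I) :
    ∫ p in U ×ˢ S, W p.swap = ∫ p in S ×ˢ U, W p :=
  setIntegral_prod_swap S U W

theorem completeSpace_graphonSignal {r : ℝ} (hr : 0 ≤ r) : CompleteSpace (GraphonSignal r) := by
  refine Metric.complete_of_convergent_controlled_sequences (fun n => (1 / 2 : ℝ) ^ n)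
    (fun n => by positivity) fun a ha => ?_
  have hex (n) : ∃ φ : CoNullBijection,
      cutNorm ((a n).graphon.toFun - kernelPull φ (a (n + 1)).graphon.toFun)
        ((a n).signal.toFun - signalPull φ (a (n + 1)).signal.toFun) < (1 / 2) ^ n := by
    by_contra! h
    exact absurd (ha n n (n + 1) le_rfl n.le_succ) (not_lt.2 (le_cutDistance h))
  choose φ hφ using hex
  -- The accumulated bijections pull every term back to the coordinates of `a 0`. Invariance of the
  -- cut norm under pullback keeps consecutive terms within `(1 / 2) ^ n`.
  let Φ : ℕ → CoNullBijection := fun n => Nat.rec CoNullBijection.refl (fun n ψ => ψ.trans (φ n)) n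
  let W : ℕ → I × I → ℝ := fun n => kernelPull (Φ n) (a n).graphon.toFun
  let f : ℕ → I → ℝ := fun n => signalPull (Φ n) (a n).signal.toFun
  have hWi (n) : Integrable (W n) := integrable_kernelPull _ (a n).graphon.integrable
  have hfi (n) : Integrable (f n) := integrable_signalPull _ (a n).signal.integrable
  have hstep (n) : cutNorm (W n - W (n + 1)) (f n - f (n + 1)) ≤ (1 / 2) ^ n := by
    have h1 : W (n + 1) = kernelPull (Φ n) (kernelPull (φ n) (a (n + 1)).graphon.toFun) :=
      kernelPull_trans (Φ n) (φ n) _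
    have h2 : f (n + 1) = signalPull (Φ n) (signalPull (φ n) (a (n + 1)).signal.toFun) :=
      signalPull_trans (Φ n) (φ n) _
    rw [h1, h2, ← kernelPull_sub, ← signalPull_sub, cutNorm_pull]
    · exact (hφ n).le
    · exact (a n).graphon.integrable.sub (integrable_kernelPull _ (a (n + 1)).graphon.integrable)
    · exact (a n).signal.integrable.sub (integrable_signalPull _ (a (n + 1)).signal.integrable)
  have hWstep {U S : Set I} (hU : MeasurableSet U) (hS : MeasurableSet S) (n) :
      |(∫ p in U ×ˢ S, W n p) - ∫ p in U ×ˢ S, W (n + 1) p| ≤ (1 / 2) ^ n := by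
    rw [← integral_sub' (hWi n).integrableOn (hWi (n + 1)).integrableOn]
    have h1 := le_kernelCutNorm ((hWi n).sub (hWi (n + 1))) hU hS
    -- Testing on the empty set shows that the signal part of the cut norm is nonnegative and can be
    -- dropped.
    have h2 := le_signalCutNorm ((hfi n).sub (hfi (n + 1))) MeasurableSet.empty
    have h3 := hstep n
    unfold cutNorm at h3
    linarith [abs_nonneg (∫ x in (∅ : Set I), (f n - f (n + 1)) x)]
  have hfstep {S : Set I} (hS : MeasurableSet S) (n) :
      |(∫ x in S, f n x) - ∫ x in S, f (n + 1) x| ≤ (1 / 2) ^ n := by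
    rw [← integral_sub' (hfi n).integrableOn (hfi (n + 1)).integrableOn]
    have h1 := le_kernelCutNorm ((hWi n).sub (hWi (n + 1))) MeasurableSet.empty MeasurableSet.empty
    have h2 := le_signalCutNorm ((hfi n).sub (hfi (n + 1))) hS
    have h3 := hstep n
    unfold cutNorm at h3
    linarith [abs_nonneg (∫ p in (∅ : Set I) ×ˢ (∅ : Set I), (W n - W (n + 1)) p)]
  obtain ⟨G, hGm, hGb, hG⟩ := exists_weak_limit (μ := (volume : Measure (I × I))) zero_le_one
    (F := fun n => (a n).graphon.toFun ∘ Prod.map (Φ n).ext (Φ n).ext)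
    (fun n => (a n).graphon.measurable.comp (measurePreserving_prod (Φ n)).measurable)
    (fun n p => (a n).graphon.mem_Icc _)
  obtain ⟨g, hgm, hgb, hg⟩ := exists_weak_limit (μ := (volume : Measure I))
    (neg_le_self hr) (F := fun n => (a n).signal.toFun ∘ (Φ n).ext)
    (fun n => (a n).signal.measurable.comp (Φ n).measurable_ext)
    (fun n x => abs_le.1 ((a n).signal.abs_le _))
  have hWeq (n) (A : Set (I × I)) : ∫ p in A, W n p =
      ∫ p in A, ((a n).graphon.toFun ∘ Prod.map (Φ n).ext (Φ n).ext) p :=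
    integral_congr_ae (ae_restrict_of_ae (kernelPull_ae (Φ n) _))
  have hfeq (n) (A : Set I) : ∫ x in A, f n x = ∫ x in A, ((a n).signal.toFun ∘ (Φ n).ext) x :=
    integral_congr_ae (ae_restrict_of_ae (signalPull_ae (Φ n) _))
  have hWsymm (n) (U S : Set I) : ∫ p in U ×ˢ S, W n p = ∫ p in S ×ˢ U, W n p := by
    rw [hWeq, hWeq, ← setIntegral_swap]
    refine integral_congr_ae (Eventually.of_forall fun p => ?_)
    exact (a n).graphon.symm _ _
  have hGclose {U S : Set I} (hU : MeasurableSet U) (hS : MeasurableSet S) (n) :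
      |(∫ p in U ×ˢ S, W n p) - ∫ p in U ×ˢ S, G p| ≤ 2 * (1 / 2) ^ n :=
    abs_sub_le_of_hyperfilter_limit (hWstep hU hS)
      (by simp only [hWeq]; exact hG _ (hU.prod hS)) n
  have hgclose {S : Set I} (hS : MeasurableSet S) (n) :
      |(∫ x in S, f n x) - ∫ x in S, g x| ≤ 2 * (1 / 2) ^ n :=
    abs_sub_le_of_hyperfilter_limit (hfstep hS) (by simp only [hfeq]; exact hg _ hS) n
  -- The weak limit `G` need not be symmetric at every point, so it is symmetrized. Since each `W n`
  -- has equal integrals over `U × S` and `S × U`, the error bound is unaffected.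
  let V : Graphon :=
    { toFun := fun p => (G p + G p.swap) / 2
      measurable := (hGm.add (hGm.comp measurable_swap)).div_const 2
      mem_Icc := fun p => by
        have h1 := hGb p
        have h2 := hGb p.swap
        constructor <;> linarith [h1.1, h1.2, h2.1, h2.2]
      symm := fun x y => by simp only [Prod.swap_prod_mk, add_comm] }
  let b : GraphonSignal r := ⟨V, ⟨g, hgm, fun x => abs_le.2 (hgb x)⟩⟩
  have hGi : Integrable G := integrable_of_abs_le hGm (B := 1) fun p => by
    rw [abs_of_nonneg (hGb p).1]; exact (hGb p).2
  have hVint (U S : Set I) : ∫ p in U ×ˢ S, V.toFun p =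
      ((∫ p in U ×ˢ S, G p) + ∫ p in S ×ˢ U, G p) / 2 := by
    have hGs : Integrable fun p : I × I => G p.swap := hGi.swap
    change ∫ p in U ×ˢ S, (G p + G p.swap) / 2 = _
    rw [integral_div, integral_add hGi.integrableOn hGs.integrableOn, setIntegral_swap]
  have hdist (n) : dist (a n) b ≤ 4 * (1 / 2) ^ n := by
    -- The distance pulls back its second argument, and here `a n` is the one to be pulled back,
    -- along `Φ n`.
    rw [dist_comm]
    refine (cutDistance_le b (a n) (Φ n)).trans ?_
    have h1 : kernelCutNorm (V.toFun - W n) ≤ 2 * (1 / 2) ^ n :=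
      kernelCutNorm_le fun U S hU hS => by
        rw [integral_sub' V.integrable.integrableOn (hWi n).integrableOn, hVint]
        have h1 := abs_le.1 (hGclose hU hS n)
        have h2 := abs_le.1 (hGclose hS hU n)
        rw [← hWsymm] at h2
        rw [abs_le]
        constructor <;> linarith [h1.1, h1.2, h2.1, h2.2]
    have h2 : signalCutNorm (g - f n) ≤ 2 * (1 / 2) ^ n :=
      signalCutNorm_le fun S hS => by
        rw [integral_sub' b.signal.integrable.integrableOn (hfi n).integrableOn, abs_sub_comm]
        exact hgclose hS n
    exact (add_le_add h1 h2).trans_eq (by ring)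
  refine ⟨b, tendsto_iff_dist_tendsto_zero.2 (squeeze_zero (fun _ => dist_nonneg) hdist ?_)⟩
  have := (tendsto_pow_atTop_nhds_zero_of_lt_one (r := (1 / 2 : ℝ)) (by norm_num)
    (by norm_num)).const_mul 4
  simpa using this

end Complete

/-! ### Total boundedness and compactness of the quotient -/

theorem totallyBounded_quotientSpace {r : ℝ} (hr : 0 < r) :
    TotallyBounded (univ : Set (QuotientSpace r)) := by
  refine Metric.totallyBounded_iff.2 fun ε hε => ?_
  -- The covering bound is available only for small radii, and a cover by smaller balls suffices.
  obtain ⟨ε', h0, h'⟩ := exists_between (lt_min hε (lt_min (by norm_num : (0 : ℝ) < 1 / 3)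
    (by positivity : 0 < 1 / (40 * r))))
  obtain ⟨h1, h2, h3⟩ : ε' < ε ∧ ε' < 1 / 3 ∧ ε' < 1 / (40 * r) := by simpa only [lt_min_iff] using h'
  obtain ⟨center, hc⟩ := exists_cover hr h0 h2 h3 (Nat.le_ceil _)
  refine ⟨range center, finite_range _, ?_⟩
  rw [biUnion_range, ← hc]
  exact iUnion_mono fun i => Metric.ball_subset_ball h1.le

theorem compactSpace_quotientSpace {r : ℝ} (hr : 0 < r) : CompactSpace (QuotientSpace r) := by
  have := completeSpace_graphonSignal hr.le
  exact ⟨isCompact_iff_totallyBounded_isComplete.2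
    ⟨totallyBounded_quotientSpace hr, completeSpace_iff_isComplete_univ.1 inferInstance⟩⟩

end GraphonSignalSpace

end

theorem mainTheorem3 (r : ℝ) (hr : 0 < r) :
    CompactSpace (GraphonSignalSpace.QuotientSpace r) ∧
    ∀ c : ℝ, 1 < c → ∃ ε₀ : ℝ, 0 < ε₀ ∧ ∀ ε : ℝ, 0 < ε → ε < ε₀ →
      ∀ k : ℕ, k = ⌈(2 : ℝ) ^ (9 * c / (4 * ε ^ 2))⌉₊ →
        ∃ center : Fin (2 ^ (k ^ 2)) → GraphonSignalSpace.QuotientSpace r,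
          (⋃ i, Metric.ball (center i) ε) = Set.univ := by
  refine ⟨GraphonSignalSpace.compactSpace_quotientSpace hr, fun c hc => ?_⟩
  -- The threshold does not depend on `c`: the cover already exists with exponent `9 / (4 * ε ^ 2)`,
  -- and a factor `c > 1` only enlarges `k`.
  refine ⟨min (1 / 3) (1 / (40 * r)), lt_min (by norm_num) (by positivity), ?_⟩
  rintro ε hε hε0 k rfl
  obtain ⟨h3, h4⟩ := lt_min_iff.1 hε0
  refine GraphonSignalSpace.exists_cover hr hε h3 h4 (le_trans ?_ (Nat.le_ceil _))
  refine Real.rpow_le_rpow_of_exponent_le (by norm_num) ?_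
  gcongr
  linarith
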